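/- Let $H$ be a separable Hilbert space and let $A$ be a self-adjoint operator in $H$ with domain $D(A)$ such that $(Ah,h)\ge C(h,h)$ for all $h\in D(A)$, for some $C>0$. Assume that $A$ has a complete orthonormal system of eigenvectors $(v_k)_{k\ge 1}$ in $H$ with eigenvalues $0<\lambda_1\le\lambda_2\le\cdots\to+\infty$. Write $h_k=(h,v_k)$ for $h\in H$. Let $\rho\in(0,1]$ and $T>0$. For $\alpha>0$ put $I^{\alpha}y(t)=\frac1{\Gamma(\alpha)}\int_0^t (t-s)^{\alpha-1}y(s)\,ds$, and let $I^0y=y$. The Caputo derivative of a continuous function $y:[0,T]\to H$ is $$D_t^\rho y(t)=\frac{d}{dt}\,I^{1-\rho}\bigl(y-y(0)\bigr)(t),\qquad 0<t\le T$$ (a left derivative at $t=T$). For $\rho=1$ it is $y'(t)$, and for $\rho<1$ and absolutely continuous $y$ it equals $\frac1{\Gamma(1-\rho)}\int_0^t (t-\xi)^{-\rho}y'(\xi)\,d\xi$ for almost every $t$, and at every point $t\in(0,T]$ at which that integral is continuous in $t$. Let $E_{\rho,\mu}(z)=\sum_{n=0}^\infty \frac{z^n}{\Gamma(\rho n+\mu)}$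 be the Mittag-Leffler function. Let $\varphi\in H$, $\psi\in D(A)$, and let $g:[0,T]\to\mathbb R$ be continuous with $g(t)\ne0$ for all $t\in[0,T]$. Consider the inverse problem $$D_t^\rho u(t)+Au(t)=g(t)f\quad(0<t\le T),\qquad u(0)=\varphi,\qquad \int_0^T u(t)\,dt=\psi .$$ A classical solution is a pair $\{u,f\}$ with $f\in H$, $u\in C([0,T];H)$, $u(t)\in D(A)$ for $0<t\le T$, and $D_t^\rho u,\ Au\in C((0,T];H)$, which satisfies these three conditions. Put $$p_{k,\rho}(t)=\int_0^t g(\eta)(t-\eta)^{\rho}E_{\rho,\rho+1}\bigl(-\lambda_k(t-\eta)^\rho\bigr)\,d\eta,\qquad q_{k,\rho}(t)=\int_0^t (t-\eta)^{\rho-1}E_{\rho,\rho}\bigl(-\lambda_k(t-\eta)^\rho\bigr)g(\eta)\,d\eta .$$ Then $p_{k,\rho}(T)\neq0$ for all $k$, and the inverse problem has exactly one classical solution $\{u,f\}$. It is given by the following series, convergent in $H$, the second one for every $t\in[0,T]$: $$f=\sum_{k=1}^\infty \frac{\psi_k-\varphi_kT E_{\rho,2}(-\lambda_kT^\rho)}{p_{k,\rho}(T)}\,v_k,$$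 $$u(t)=\sum_{k=1}^\infty\left[\varphi_kE_{\rho,1}(-\lambda_kt^\rho)+\frac{q_{k,\rho}(t)}{p_{k,\rho}(T)}\bigl(\psi_k-\varphi_kTE_{\rho,2}(-\lambda_kT^\rho)\bigr)\right]v_k .$$ -/

import Mathlib

open Set MeasureTheory

noncomputable section

/-- The two-parameter Mittag-Leffler function `E_{ρ,μ}(z) = ∑ zⁿ / Γ(ρ n + μ)` at real arguments. -/
def mittagLeffler (ρ μ z : ℝ) : ℝ :=
  ∑' n : ℕ, z ^ n / Real.Gamma (ρ * n + μ)

/-- `p_{λ,ρ}(t) = ∫₀ᵗ g(η) (t - η)^ρ E_{ρ,ρ+1}(-λ (t - η)^ρ) dη`. -/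
def pCoeff (g : ℝ → ℝ) (ρ lam t : ℝ) : ℝ :=
  ∫ η in (0 : ℝ)..t, g η * (t - η) ^ ρ * mittagLeffler ρ (ρ + 1) (-lam * (t - η) ^ ρ)

/-- `q_{λ,ρ}(t) = ∫₀ᵗ (t - η)^(ρ-1) E_{ρ,ρ}(-λ (t - η)^ρ) g(η) dη`, the solution of the scalar
Cauchy problem `D_t^ρ y + λ y = g`, `y(0) = 0`. -/
def qCoeff (g : ℝ → ℝ) (ρ lam t : ℝ) : ℝ :=
  ∫ η in (0 : ℝ)..t, (t - η) ^ (ρ - 1) * mittagLeffler ρ ρ (-lam * (t - η) ^ ρ) * g η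

/-- The Riemann-Liouville fractional integral of order `α ≥ 0` with base point `0`;
the integral of order `0` is the identity. -/
def fracIntegral {H : Type*} [NormedAddCommGroup H] [NormedSpace ℝ H]
    (α : ℝ) (y : ℝ → H) (t : ℝ) : H :=
  if α = 0 then y t
  else (Real.Gamma α)⁻¹ • ∫ s in (0 : ℝ)..t, (t - s) ^ (α - 1) • y s

/-- The function `y` on `[0, T]` has at each point of `(0, T]` a Caputo derivative of order
`ρ ∈ (0, 1]`, with value `w t` at `t`, where `D_t^ρ y = d/dt I^{1-ρ} (y - y 0)`. The derivative is
one-sided at `T`. For `ρ = 1` this is the ordinary derivative. -/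
def HasCaputoDerivOn {H : Type*} [NormedAddCommGroup H] [NormedSpace ℝ H]
    (ρ T : ℝ) (y w : ℝ → H) : Prop :=
  ∀ t ∈ Ioc 0 T,
    HasDerivWithinAt (fracIntegral (1 - ρ) (fun s => y s - y 0)) (w t) (Icc 0 T) t

/-- `(u, f)` is a classical solution of the inverse problem
`D_t^ρ u + A u = g(t) f` on `(0, T]`, `u(0) = φ`, `∫₀ᵀ u dt = ψ`:
`u ∈ C([0, T]; H)`, `f ∈ H`, and `D_t^ρ u, A u ∈ C((0, T]; H)`. -/
structure IsClassicalSolution {𝕜 H : Type*} [RCLike 𝕜] [NormedAddCommGroup H]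
    [InnerProductSpace 𝕜 H] [NormedSpace ℝ H]
    (A : H →ₗ.[𝕜] H) (ρ T : ℝ) (g : ℝ → ℝ) (φ ψ : H) (u : ℝ → H) (f : H) : Prop where
  continuousOn : ContinuousOn u (Icc 0 T)
  equation : ∃ Du Au : ℝ → H,
    HasCaputoDerivOn ρ T u Du ∧
    (∀ t ∈ Ioc 0 T, ∃ h : u t ∈ A.domain, A ⟨u t, h⟩ = Au t) ∧
    ContinuousOn Du (Ioc 0 T) ∧
    ContinuousOn Au (Ioc 0 T) ∧
    ∀ t ∈ Ioc 0 T, Du t + Au t = (g t : 𝕜) • f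
  initial : u 0 = φ
  integral : ∫ t in (0 : ℝ)..T, u t = ψ

/-- `f_k = (ψ_k - φ_k T E_{ρ,2}(-λ T^ρ)) / p_{λ,ρ}(T)`, for Fourier coefficients `φ_k`, `ψ_k`. -/
def sourceCoeff {𝕜 : Type*} [RCLike 𝕜] (g : ℝ → ℝ) (ρ T lam : ℝ) (φk ψk : 𝕜) : 𝕜 :=
  (ψk - φk * ((T * mittagLeffler ρ 2 (-lam * T ^ ρ) : ℝ) : 𝕜)) / ((pCoeff g ρ lam T : ℝ) : 𝕜)

end

/-!
Expanding in the eigenbasis reduces the inverse problem to the scalar problems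
`D_t^ρ u_k + λ_k u_k = g f_k`, `u_k(0) = φ_k`, `∫ u_k = ψ_k`. Everything about them is expressed by
the relaxation kernel `e(t) = t ^ (ρ - 1) E_{ρ,ρ}(-λ t ^ ρ)` (`relaxKernel`) and the relaxation
function `y(t) = E_{ρ,1}(-λ t ^ ρ)` (`relaxFun`). Termwise fractional integration of the
Mittag-Leffler series (`integral_sub_rpow_mul_mittagLeffler`) gives the identities `λ ∫ e = 1 - y`,
`I^{1-ρ} e = y`, `λ I^ρ y = 1 - y` and a Volterra equation for `e`.

Scalar problem. By associativity of truncated convolution (`truncConv_truncConv`), `w = e * h`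
satisfies `I^{1-ρ} w = y * h = ∫ (h - λ w)`, and conversely convolving `I^{1-ρ} w = ∫ (h - λ w)`
with `e` gives `∫ w = ∫ (e * h)`, so `w = e * h`. Applied to `w = u_k - φ_k` and
`h = g f_k - λ_k φ_k` this says `u_k = φ_k y + f_k q_k`; integrating over `[0, T]`, where
`∫ q_k = p_k(T)`, determines `f_k`. This yields uniqueness and the formulas.

Positivity. That `e > 0` (`relaxKernel_pos`) is proved from the Volterra equation: the kernel
`t ^ (ρ - 1)` is log-convex, which forbids a first zero of `e`. Consequently `y` is nonnegative and
decreasing, in `t` and in `λ`, and the identities above turn into bounds uniform in `λ`: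
`λ |q(t)| ≤ sup |g|`, `λ y(t) ≤ C t ^ (-ρ)`, `λ ∫ y ≤ C`. Since `g` has constant sign, also
`λ |p(T)| ≥ c > 0` (`exists_pos_le_mul_abs_pCoeff`).

Existence. These bounds and `ψ ∈ D(A)` make `(f_k)` square-summable, and dominate the coefficients
of `u` on `[0, T]` and of `A u` on each `[δ, T]` in `ℓ²`. So `u` and `A u` are continuous there,
`u(t) ∈ D(A)` because `A` is closed, and the integrated scalar equations, differentiated on
`[δ, T]`, give the Caputo derivative of `u` (`HilbertBasis.hasCaputoDerivOn`).
-/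

/-! ### The Mittag-Leffler series -/

/-- Convexity of `log Γ` on `x - 1 < x < x + ρ`. -/
lemma Real.Gamma_div_Gamma_add_le {x ρ : ℝ} (hx : 1 < x) (hρ : 0 < ρ) :
    Real.Gamma x / Real.Gamma (x + ρ) ≤ (x - 1) ^ (-ρ) := by
  have h0 : 0 < x - 1 := by linarith
  have hG := Real.Gamma_pos_of_pos h0
  have hG1 := Real.Gamma_pos_of_pos (show 0 < x by linarith)
  have hG2 := Real.Gamma_pos_of_pos (show 0 < x + ρ by linarith)
  have h := Real.convexOn_log_Gamma.slope_mono_adjacent (x := x - 1) (y := x) (z := x + ρ)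
    h0 (show 0 < x + ρ by linarith) (by linarith) (by linarith)
  have hrec : Real.Gamma x = (x - 1) * Real.Gamma (x - 1) := by
    have := Real.Gamma_add_one h0.ne'
    rwa [sub_add_cancel] at this
  simp only [Function.comp] at h
  rw [show x - (x - 1) = 1 by ring, div_one, show x + ρ - x = ρ by ring, le_div_iff₀ hρ] at h
  have h1 : Real.log (Real.Gamma x) = Real.log (x - 1) + Real.log (Real.Gamma (x - 1)) := by
    rw [hrec, Real.log_mul h0.ne' hG.ne']
  rw [← Real.log_le_log_iff (by positivity) (by positivity), Real.log_div hG1.ne' hG2.ne',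
    Real.log_rpow h0]
  nlinarith

lemma summable_mittagLeffler {ρ μ : ℝ} (hρ : 0 < ρ) (hμ : 0 < μ) (z : ℝ) :
    Summable fun n : ℕ => z ^ n / Real.Gamma (ρ * n + μ) := by
  have hG : ∀ n : ℕ, 0 < Real.Gamma (ρ * n + μ) := fun n => Real.Gamma_pos_of_pos (by positivity)
  rcases eq_or_ne z 0 with rfl | hz
  · refine summable_of_ne_finset_zero (s := {0}) fun n hn => ?_
    rw [zero_pow (by simpa using hn), zero_div]
  refine summable_of_ratio_test_tendsto_lt_one (l := 0) one_pos
    (Filter.Eventually.of_forall fun n => div_ne_zero (pow_ne_zero _ hz) (hG n).ne') ?_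
  have hlin : Filter.Tendsto (fun n : ℕ => ρ * n + μ - 1) Filter.atTop Filter.atTop := by
    simp only [add_sub_assoc]
    exact Filter.tendsto_atTop_add_const_right _ _
      (tendsto_natCast_atTop_atTop.const_mul_atTop hρ)
  have hlim : Filter.Tendsto (fun n : ℕ => |z| * (ρ * n + μ - 1) ^ (-ρ)) Filter.atTop
      (nhds (|z| * 0)) := ((tendsto_rpow_neg_atTop hρ).comp hlin).const_mul _
  rw [mul_zero] at hlim
  refine squeeze_zero' (Filter.Eventually.of_forall fun n => by positivity) ?_ hlim
  filter_upwards [hlin.eventually_gt_atTop 0] with n hn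
  have key := Real.Gamma_div_Gamma_add_le (x := ρ * n + μ) (by linarith) hρ
  have hx : ρ * ((n + 1 : ℕ) : ℝ) + μ = ρ * n + μ + ρ := by push_cast; ring
  have hG' := hG (n + 1)
  rw [hx] at hG' ⊢
  rw [norm_div, norm_div, norm_pow, norm_pow, Real.norm_of_nonneg (hG n).le,
    Real.norm_of_nonneg hG'.le, Real.norm_eq_abs, pow_succ]
  have : |z| ^ n * |z| / Real.Gamma (ρ * n + μ + ρ) / (|z| ^ n / Real.Gamma (ρ * n + μ))
      = |z| * (Real.Gamma (ρ * n + μ) / Real.Gamma (ρ * n + μ + ρ)) := by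
    have : |z| ≠ 0 := abs_ne_zero.mpr hz
    have := (hG n).ne'
    field_simp
  rw [this]
  gcongr

lemma continuous_mittagLeffler {ρ μ : ℝ} (hρ : 0 < ρ) (hμ : 0 < μ) :
    Continuous (mittagLeffler ρ μ) := by
  have hG : ∀ n : ℕ, 0 < Real.Gamma (ρ * n + μ) := fun n => Real.Gamma_pos_of_pos (by positivity)
  rw [continuous_iff_continuousAt]
  intro z
  have : ContinuousOn (mittagLeffler ρ μ) (Metric.ball 0 (|z| + 1)) := by
    refine continuousOn_tsum (u := fun n : ℕ => (|z| + 1) ^ n / Real.Gamma (ρ * n + μ))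
      (fun n => by fun_prop) (summable_mittagLeffler hρ hμ _) fun n x hx => ?_
    rw [norm_div, norm_pow, Real.norm_of_nonneg (hG n).le]
    rw [mem_ball_zero_iff] at hx
    have := (hG n).le
    gcongr
  exact this.continuousAt (Metric.isOpen_ball.mem_nhds (by simp))

lemma mittagLeffler_zero (ρ μ : ℝ) : mittagLeffler ρ μ 0 = (Real.Gamma μ)⁻¹ := by
  rw [mittagLeffler, tsum_eq_single 0 fun n hn => by rw [zero_pow hn, zero_div]]
  simp

lemma mittagLeffler_eq_add_mul {ρ μ : ℝ} (hρ : 0 < ρ) (hμ : 0 < μ) (z : ℝ) :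
    mittagLeffler ρ μ z = (Real.Gamma μ)⁻¹ + z * mittagLeffler ρ (μ + ρ) z := by
  rw [mittagLeffler, (summable_mittagLeffler hρ hμ z).tsum_eq_zero_add, mittagLeffler,
    ← tsum_mul_left]
  congr 1
  · simp
  · refine tsum_congr fun n => ?_
    rw [show ρ * ((n + 1 : ℕ) : ℝ) + μ = ρ * n + (μ + ρ) by push_cast; ring, pow_succ]
    ring

/-! ### Fractional integrals of Mittag-Leffler functions -/

lemma intervalIntegrable_sub_rpow_mul_rpow {α β t : ℝ} (hα : 0 < α) (hβ : 0 < β) (ht : 0 < t) :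
    IntervalIntegrable (fun s => (t - s) ^ (α - 1) * s ^ (β - 1)) volume 0 t := by
  have h1 : IntervalIntegrable (fun s : ℝ => s ^ (β - 1)) volume 0 (t / 2) :=
    intervalIntegral.intervalIntegrable_rpow' (by linarith)
  have h2 : IntervalIntegrable (fun s : ℝ => (t - s) ^ (α - 1)) volume (t / 2) t := by
    have := (intervalIntegral.intervalIntegrable_rpow' (a := 0) (b := t / 2)
      (r := α - 1) (by linarith)).comp_sub_left t
    rw [sub_zero, sub_half] at this
    exact this.symm
  refine IntervalIntegrable.trans (b := t / 2) (h1.continuousOn_mul ?_) (h2.mul_continuousOn ?_)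
  · rw [uIcc_of_le (by linarith)]
    exact ContinuousOn.rpow_const (by fun_prop) fun s hs => Or.inl (by linarith [hs.2])
  · rw [uIcc_of_le (by linarith)]
    exact ContinuousOn.rpow_const (by fun_prop) fun s hs => Or.inl (by linarith [hs.1])

lemma integral_sub_rpow_mul_rpow {α β t : ℝ} (hα : 0 < α) (hβ : 0 < β) (ht : 0 < t) :
    ∫ s in (0 : ℝ)..t, (t - s) ^ (α - 1) * s ^ (β - 1)
      = Real.Gamma α * Real.Gamma β / Real.Gamma (α + β) * t ^ (α + β - 1) := by
  have h := Complex.betaIntegral_scaled (β : ℂ) (α : ℂ) ht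
  rw [Complex.betaIntegral_eq_Gamma_mul_div _ _ (by simpa) (by simpa)] at h
  have h' : ((∫ s in (0 : ℝ)..t, (t - s) ^ (α - 1) * s ^ (β - 1) : ℝ) : ℂ)
      = ((Real.Gamma α * Real.Gamma β / Real.Gamma (α + β) * t ^ (α + β - 1) : ℝ) : ℂ) := by
    rw [← intervalIntegral.integral_ofReal]
    trans ∫ x in (0 : ℝ)..t, (x : ℂ) ^ ((β : ℂ) - 1) * ((t : ℂ) - x) ^ ((α : ℂ) - 1)
    · refine intervalIntegral.integral_congr fun s hs => ?_
      rw [uIcc_of_le ht.le] at hs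
      simp only [Complex.ofReal_mul]
      rw [Complex.ofReal_cpow (by linarith [hs.2]), Complex.ofReal_cpow hs.1, mul_comm]
      push_cast
      rfl
    · rw [h]
      push_cast [Complex.ofReal_cpow ht.le, ← Complex.Gamma_ofReal]
      rw [add_comm (β : ℂ) α]
      ring
  exact_mod_cast h'

lemma rpow_mul_mittagLeffler_term {ρ μ c s : ℝ} (hs : 0 < s) (n : ℕ) :
    s ^ (μ - 1) * ((c * s ^ ρ) ^ n / Real.Gamma (ρ * n + μ))
      = c ^ n / Real.Gamma (ρ * n + μ) * s ^ (ρ * n + μ - 1) := by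
  rw [mul_pow, ← Real.rpow_natCast (s ^ ρ), ← Real.rpow_mul hs.le, add_sub_assoc,
    Real.rpow_add hs]
  ring

/-- Fractional integration of order `α` sends `s ^ (μ - 1) E_{ρ,μ}(c s ^ ρ)` to
`t ^ (μ + α - 1) E_{ρ,μ+α}(c t ^ ρ)`. -/
lemma integral_sub_rpow_mul_mittagLeffler {ρ μ α : ℝ} (hρ : 0 < ρ) (hμ : 0 < μ) (hα : 0 < α)
    (c : ℝ) {t : ℝ} (ht : 0 < t) :
    ∫ s in (0 : ℝ)..t, (t - s) ^ (α - 1) * (s ^ (μ - 1) * mittagLeffler ρ μ (c * s ^ ρ))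
      = Real.Gamma α * (t ^ (μ + α - 1) * mittagLeffler ρ (μ + α) (c * t ^ ρ)) := by
  have hβ : ∀ n : ℕ, 0 < ρ * n + μ := fun n => by positivity
  set F : ℕ → ℝ → ℝ := fun n s =>
    c ^ n / Real.Gamma (ρ * n + μ) * ((t - s) ^ (α - 1) * s ^ (ρ * n + μ - 1)) with hF
  have hFint : ∀ n, ∫ s in (0 : ℝ)..t, F n s
      = Real.Gamma α * (t ^ (μ + α - 1) * ((c * t ^ ρ) ^ n / Real.Gamma (ρ * n + (μ + α)))) := by
    intro n
    rw [rpow_mul_mittagLeffler_term ht, hF, intervalIntegral.integral_const_mul,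
      integral_sub_rpow_mul_rpow hα (hβ n) ht]
    have := (Real.Gamma_pos_of_pos (hβ n)).ne'
    rw [show α + (ρ * n + μ) = ρ * n + (μ + α) by ring]
    field_simp
  have hsum : HasSum (fun n => ∫ s in Ioc 0 t, F n s) (∫ s in Ioc 0 t, ∑' n, F n s) := by
    refine hasSum_integral_of_summable_integral_norm (fun n => ?_) ?_
    · exact (intervalIntegrable_iff_integrableOn_Ioc_of_le ht.le).mp
        ((intervalIntegrable_sub_rpow_mul_rpow hα (hβ n) ht).const_mul _)
    · have hs := ((summable_mittagLeffler hρ (add_pos hμ hα) (|c| * t ^ ρ)).mul_left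
        (t ^ (μ + α - 1))).mul_left (Real.Gamma α)
      refine hs.congr fun n => ?_
      rw [rpow_mul_mittagLeffler_term ht]
      have h1 : ∫ s in Ioc 0 t, ‖F n s‖ = ∫ s in Ioc 0 t, |c| ^ n / Real.Gamma (ρ * n + μ) *
          ((t - s) ^ (α - 1) * s ^ (ρ * n + μ - 1)) := by
        refine setIntegral_congr_fun measurableSet_Ioc fun s hs => ?_
        have h1 : 0 ≤ (t - s) ^ (α - 1) := Real.rpow_nonneg (by linarith [hs.2]) _
        have h2 : 0 ≤ s ^ (ρ * n + μ - 1) := Real.rpow_nonneg hs.1.le _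
        have h3 := (Real.Gamma_pos_of_pos (hβ n)).le
        simp only [hF, norm_mul, norm_div, norm_pow, Real.norm_eq_abs, abs_of_nonneg h1,
          abs_of_nonneg h2, abs_of_nonneg h3]
      rw [h1, ← intervalIntegral.integral_of_le ht.le, intervalIntegral.integral_const_mul,
        integral_sub_rpow_mul_rpow hα (hβ n) ht]
      have := (Real.Gamma_pos_of_pos (hβ n)).ne'
      rw [show α + (ρ * n + μ) = ρ * n + (μ + α) by ring]
      field_simp
  simp only [← intervalIntegral.integral_of_le ht.le, hFint] at hsum
  have h2 := hsum.tsum_eq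
  rw [tsum_mul_left, tsum_mul_left] at h2
  rw [mittagLeffler, h2, intervalIntegral.integral_of_le ht.le,
    intervalIntegral.integral_of_le ht.le]
  refine setIntegral_congr_fun measurableSet_Ioc fun s hs => ?_
  simp only [mittagLeffler, hF]
  rw [← tsum_mul_left, ← tsum_mul_left]
  refine tsum_congr fun n => ?_
  rw [rpow_mul_mittagLeffler_term hs.1]
  ring

/-! ### The relaxation kernel and its positivity -/

/-- The function `e(t) = t ^ (ρ - 1) E_{ρ,ρ}(-λ t ^ ρ)`, the kernel of the solution operator
of the scalar problem `D_t^ρ w + λ w = h`, `w(0) = 0`: the solution is `∫₀ᵗ e(t - s) h(s) ds`. -/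
noncomputable def relaxKernel (ρ lam t : ℝ) : ℝ :=
  t ^ (ρ - 1) * mittagLeffler ρ ρ (-lam * t ^ ρ)

/-- The function `y(t) = E_{ρ,1}(-λ t ^ ρ)`, the solution of `D_t^ρ y + λ y = 0`, `y(0) = 1`. -/
noncomputable def relaxFun (ρ lam t : ℝ) : ℝ :=
  mittagLeffler ρ 1 (-lam * t ^ ρ)

lemma continuous_relaxFun {ρ : ℝ} (hρ : 0 < ρ) (lam : ℝ) : Continuous (relaxFun ρ lam) :=
  (continuous_mittagLeffler hρ one_pos).comp
    (continuous_const.mul (Real.continuous_rpow_const hρ.le))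

lemma relaxFun_zero {ρ : ℝ} (hρ : 0 < ρ) (lam : ℝ) : relaxFun ρ lam 0 = 1 := by
  rw [relaxFun, Real.zero_rpow hρ.ne', mul_zero, mittagLeffler_zero, Real.Gamma_one, inv_one]

lemma continuousOn_relaxKernel {ρ : ℝ} (hρ : 0 < ρ) (lam : ℝ) :
    ContinuousOn (relaxKernel ρ lam) (Ioi 0) :=
  (ContinuousOn.rpow_const continuousOn_id fun _ hs => Or.inl (ne_of_gt hs)).mul
    ((continuous_mittagLeffler hρ hρ).comp
      (continuous_const.mul (Real.continuous_rpow_const hρ.le))).continuousOn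

lemma intervalIntegrable_relaxKernel {ρ : ℝ} (hρ : 0 < ρ) (lam a b : ℝ) :
    IntervalIntegrable (relaxKernel ρ lam) volume a b :=
  (intervalIntegral.intervalIntegrable_rpow' (by linarith)).mul_continuousOn
    ((continuous_mittagLeffler hρ hρ).comp
      (continuous_const.mul (Real.continuous_rpow_const hρ.le))).continuousOn

lemma integral_relaxKernel_eq {ρ : ℝ} (hρ : 0 < ρ) (lam : ℝ) {t : ℝ} (ht : 0 ≤ t) :
    ∫ s in (0 : ℝ)..t, relaxKernel ρ lam s = t ^ ρ * mittagLeffler ρ (ρ + 1) (-lam * t ^ ρ) := by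
  rcases ht.eq_or_lt with rfl | ht
  · simp [Real.zero_rpow hρ.ne']
  · have h := integral_sub_rpow_mul_mittagLeffler hρ hρ one_pos (-lam) ht
    simpa [relaxKernel] using h

/-- `y = 1 - λ ∫ e`. -/
lemma mul_integral_relaxKernel {ρ : ℝ} (hρ : 0 < ρ) (lam : ℝ) {t : ℝ} (ht : 0 ≤ t) :
    lam * ∫ s in (0 : ℝ)..t, relaxKernel ρ lam s = 1 - relaxFun ρ lam t := by
  rw [integral_relaxKernel_eq hρ lam ht, relaxFun, mittagLeffler_eq_add_mul hρ one_pos,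
    Real.Gamma_one, add_comm ρ 1]
  ring

/-- `e + λ I^ρ e = t ^ (ρ - 1) / Γ(ρ)`. -/
lemma relaxKernel_add {ρ : ℝ} (hρ : 0 < ρ) (lam : ℝ) {t : ℝ} (ht : 0 < t) :
    relaxKernel ρ lam t
      + lam * ((Real.Gamma ρ)⁻¹ * ∫ s in (0 : ℝ)..t, (t - s) ^ (ρ - 1) * relaxKernel ρ lam s)
      = (Real.Gamma ρ)⁻¹ * t ^ (ρ - 1) := by
  have h := integral_sub_rpow_mul_mittagLeffler hρ hρ hρ (-lam) ht
  have hG := (Real.Gamma_pos_of_pos hρ).ne'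
  simp only [relaxKernel]
  rw [h, mittagLeffler_eq_add_mul hρ hρ, add_sub_right_comm, Real.rpow_add ht]
  field_simp
  ring

/-- `I^{1-ρ} e = y`. -/
lemma integral_rpow_mul_relaxKernel {ρ : ℝ} (hρ : 0 < ρ) (hρ1 : ρ < 1) (lam : ℝ) {t : ℝ}
    (ht : 0 < t) :
    (Real.Gamma (1 - ρ))⁻¹ * ∫ s in (0 : ℝ)..t, (t - s) ^ (1 - ρ - 1) * relaxKernel ρ lam s
      = relaxFun ρ lam t := by
  have h := integral_sub_rpow_mul_mittagLeffler hρ hρ (sub_pos.2 hρ1) (-lam) ht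
  have hG := (Real.Gamma_pos_of_pos (sub_pos.2 hρ1)).ne'
  simp only [relaxKernel]
  rw [h, add_sub_cancel, sub_self, Real.rpow_zero, one_mul, inv_mul_cancel_left₀ hG, relaxFun]

/-- `λ I^ρ y = 1 - y`. -/
lemma integral_rpow_mul_relaxFun {ρ : ℝ} (hρ : 0 < ρ) (lam : ℝ) {t : ℝ} (ht : 0 < t) :
    lam * ∫ s in (0 : ℝ)..t, (t - s) ^ (ρ - 1) * relaxFun ρ lam s
      = Real.Gamma ρ * (1 - relaxFun ρ lam t) := by
  have h := integral_sub_rpow_mul_mittagLeffler hρ one_pos hρ (-lam) ht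
  simp only [sub_self, Real.rpow_zero, one_mul] at h
  simp only [relaxFun]
  rw [h, mittagLeffler_eq_add_mul hρ one_pos (-lam * t ^ ρ), Real.Gamma_one,
    show (1 : ℝ) + ρ - 1 = ρ by ring]
  ring

lemma integral_relaxFun {ρ : ℝ} (hρ : 0 < ρ) (lam : ℝ) {t : ℝ} (ht : 0 < t) :
    ∫ s in (0 : ℝ)..t, relaxFun ρ lam s = t * mittagLeffler ρ 2 (-lam * t ^ ρ) := by
  have h := integral_sub_rpow_mul_mittagLeffler hρ one_pos one_pos (-lam) ht
  simp only [sub_self, Real.rpow_zero, one_mul, Real.Gamma_one, one_add_one_eq_two] at h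
  rw [show (2 : ℝ) - 1 = 1 by norm_num, Real.rpow_one] at h
  exact h

/-- The step that excludes a first zero of `e`. If `e ≤ e(r)` on `[r, t]` and `e ≥ 0` before `r`,
then the Volterra equation at `t`, compared with the one at `r` through the log-convexity
`(t - s) ^ (ρ - 1) ≤ (t / r) ^ (ρ - 1) (r - s) ^ (ρ - 1)`, bounds `e(t)` from below. -/
lemma relaxKernel_lower_bound {ρ lam r t : ℝ} (hρ : 0 < ρ) (hρ1 : ρ ≤ 1) (hlam : 0 ≤ lam)
    (hr : 0 < r) (hrt : r ≤ t) (hpos : ∀ s ∈ Ioo 0 r, 0 ≤ relaxKernel ρ lam s)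
    (hmax : ∀ s ∈ Icc r t, relaxKernel ρ lam s ≤ relaxKernel ρ lam r) :
    relaxKernel ρ lam r
        * ((t / r) ^ (ρ - 1) - lam * (Real.Gamma ρ)⁻¹ * ((t - r) ^ ρ / ρ))
      ≤ relaxKernel ρ lam t := by
  have ht : 0 < t := hr.trans_le hrt
  have hG := Real.Gamma_pos_of_pos hρ
  have hint : ∀ x, 0 < x → IntervalIntegrable
      (fun s => (x - s) ^ (ρ - 1) * relaxKernel ρ lam s) volume 0 x := fun x hx => by
    have := (intervalIntegrable_sub_rpow_mul_rpow hρ hρ hx).mul_continuousOn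
      ((continuous_mittagLeffler hρ hρ).comp
        (continuous_const.mul (Real.continuous_rpow_const hρ.le))).continuousOn (g :=
          (mittagLeffler ρ ρ) ∘ fun s => -lam * s ^ ρ)
    refine this.congr fun s _ => ?_
    simp only [relaxKernel, Function.comp, mul_assoc]
  have hi1 := (hint t ht).mono_set (c := 0) (d := r) (by
    rw [uIcc_of_le hr.le, uIcc_of_le ht.le]; exact Icc_subset_Icc_right hrt)
  have hi2 := (hint t ht).mono_set (c := r) (d := t) (by
    rw [uIcc_of_le hrt, uIcc_of_le ht.le]; exact Icc_subset_Icc_left hr.le)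
  have h1 : ∫ s in (0 : ℝ)..r, (t - s) ^ (ρ - 1) * relaxKernel ρ lam s
      ≤ (t / r) ^ (ρ - 1) * ∫ s in (0 : ℝ)..r, (r - s) ^ (ρ - 1) * relaxKernel ρ lam s := by
    rw [← intervalIntegral.integral_const_mul]
    refine intervalIntegral.integral_mono_on_of_le_Ioo hr.le hi1 ((hint r hr).const_mul _)
      fun s hs => ?_
    rw [← mul_assoc, ← Real.mul_rpow (by positivity) (by linarith [hs.2])]
    refine mul_le_mul_of_nonneg_right ?_ (hpos s hs)
    have hrs : 0 < r - s := by linarith [hs.2]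
    refine Real.rpow_le_rpow_of_nonpos (by positivity) ?_ (by linarith)
    rw [div_mul_eq_mul_div, div_le_iff₀ hr]
    nlinarith [hs.1]
  have h2 : ∫ s in r..t, (t - s) ^ (ρ - 1) * relaxKernel ρ lam s
      ≤ relaxKernel ρ lam r * ((t - r) ^ ρ / ρ) := by
    have hk : IntervalIntegrable (fun s : ℝ => (t - s) ^ (ρ - 1)) volume r t := by
      have := (intervalIntegral.intervalIntegrable_rpow' (a := 0) (b := t - r)
        (r := ρ - 1) (by linarith)).comp_sub_left t
      rw [sub_zero, sub_sub_cancel] at this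
      exact this.symm
    have hkint : ∫ s in r..t, (t - s) ^ (ρ - 1) = (t - r) ^ ρ / ρ := by
      rw [intervalIntegral.integral_comp_sub_left (fun s => s ^ (ρ - 1)) t, sub_self,
        integral_rpow (Or.inl (by linarith)), sub_add_cancel, Real.zero_rpow hρ.ne', sub_zero]
    rw [← hkint, ← intervalIntegral.integral_const_mul]
    refine intervalIntegral.integral_mono_on hrt hi2 (hk.const_mul _) fun s hs => ?_
    rw [mul_comm]
    exact mul_le_mul_of_nonneg_right (hmax s hs) (Real.rpow_nonneg (by linarith [hs.2]) _)
  have het := relaxKernel_add hρ lam ht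
  have her := relaxKernel_add hρ lam hr
  rw [← intervalIntegral.integral_add_adjacent_intervals hi1 hi2] at het
  have hdiv : (t / r) ^ (ρ - 1) * r ^ (ρ - 1) = t ^ (ρ - 1) := by
    rw [← Real.mul_rpow (by positivity) hr.le, div_mul_cancel₀ _ hr.ne']
  set X := ∫ s in (0 : ℝ)..r, (t - s) ^ (ρ - 1) * relaxKernel ρ lam s
  set Y := ∫ s in r..t, (t - s) ^ (ρ - 1) * relaxKernel ρ lam s
  set Z := ∫ s in (0 : ℝ)..r, (r - s) ^ (ρ - 1) * relaxKernel ρ lam s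
  have hl : 0 ≤ lam * (Real.Gamma ρ)⁻¹ := by positivity
  have h3 := mul_le_mul_of_nonneg_left (add_le_add h1 h2) hl
  rw [← hdiv] at het
  linear_combination h3 - het + (t / r) ^ (ρ - 1) * her

/-- `E_{ρ,ρ}` is positive on the negative half-line. -/
lemma relaxKernel_pos {ρ lam t : ℝ} (hρ : 0 < ρ) (hρ1 : ρ ≤ 1) (hlam : 0 ≤ lam) (ht : 0 < t) :
    0 < relaxKernel ρ lam t := by
  set z : ℝ → ℝ := fun s => mittagLeffler ρ ρ (-lam * s ^ ρ) with hz
  have hzc : Continuous z := (continuous_mittagLeffler hρ hρ).comp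
      (continuous_const.mul (Real.continuous_rpow_const hρ.le))
  have hez : ∀ s, relaxKernel ρ lam s = s ^ (ρ - 1) * z s := fun s => rfl
  by_contra hneg
  set S : Set ℝ := Icc 0 t ∩ {s | z s ≤ 0} with hS
  have hSc : IsCompact S := isCompact_Icc.inter_right (isClosed_le hzc continuous_const)
  have htS : t ∈ S := by
    refine ⟨⟨ht.le, le_rfl⟩, ?_⟩
    by_contra h
    exact hneg (mul_pos (Real.rpow_pos_of_pos ht _) (not_le.1 h))
  -- `t₀` is the first point where `z` is not positive
  obtain ⟨t₀, ht₀, hmin⟩ := hSc.exists_isLeast ⟨t, htS⟩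
  have ht₀z : z t₀ ≤ 0 := ht₀.2
  have h0 : 0 < t₀ := by
    refine ht₀.1.1.lt_of_ne fun h => ?_
    rw [← h] at ht₀z
    simp only [hz, Real.zero_rpow hρ.ne', mul_zero, mittagLeffler_zero] at ht₀z
    exact absurd ht₀z (not_le.2 (inv_pos.2 (Real.Gamma_pos_of_pos hρ)))
  have hpos : ∀ s ∈ Ioo 0 t₀, 0 < relaxKernel ρ lam s := fun s hs => by
    refine mul_pos (Real.rpow_pos_of_pos hs.1 _) ?_
    by_contra h
    exact absurd (hmin ⟨⟨hs.1.le, hs.2.le.trans ht₀.1.2⟩, not_lt.1 h⟩) (not_le.2 hs.2)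
  have het₀ : relaxKernel ρ lam t₀ ≤ 0 :=
    mul_nonpos_of_nonneg_of_nonpos (Real.rpow_nonneg h0.le _) ht₀z
  have hlim : Filter.Tendsto
      (fun r => (t₀ / r) ^ (ρ - 1) - lam * (Real.Gamma ρ)⁻¹ * ((t₀ - r) ^ ρ / ρ))
      (nhds t₀) (nhds 1) := by
    have : ContinuousAt
        (fun r => (t₀ / r) ^ (ρ - 1) - lam * (Real.Gamma ρ)⁻¹ * ((t₀ - r) ^ ρ / ρ)) t₀ := by
      refine ContinuousAt.sub ?_ (continuousAt_const.mul (ContinuousAt.div_const ?_ _))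
      · exact ContinuousAt.rpow_const (continuousAt_const.div continuousAt_id h0.ne')
          (Or.inl (by simp [h0.ne']))
      · exact ContinuousAt.rpow_const (by fun_prop) (Or.inr hρ.le)
    convert this.tendsto using 2
    simp [h0.ne', Real.zero_rpow hρ.ne']
  obtain ⟨l, ⟨hl0, hlt⟩, hsub⟩ := (mem_nhdsLE_iff_exists_mem_Ico_Ioc_subset (half_lt_self h0)).1
    (mem_nhdsWithin_of_mem_nhds (hlim.eventually_const_lt zero_lt_one))
  obtain ⟨a, hla, hat⟩ := exists_between hlt
  have ha0 : 0 < a := by linarith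
  -- `r` maximizes `e` on a short interval `[a, t₀]`, hence `e ≤ e(r)` on `[r, t₀]`
  obtain ⟨r, hr, hrmax⟩ := isCompact_Icc.exists_isMaxOn (nonempty_Icc.2 hat.le)
    ((continuousOn_relaxKernel hρ lam).mono fun s (hs : s ∈ Icc a t₀) => ha0.trans_le hs.1)
  have her : 0 < relaxKernel ρ lam r :=
    (hpos a ⟨ha0, hat⟩).trans_le (hrmax (left_mem_Icc.2 hat.le))
  have hr0 : 0 < r := ha0.trans_le hr.1
  have hlow := relaxKernel_lower_bound hρ hρ1 hlam hr0 hr.2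
    (fun s hs => (hpos s ⟨hs.1, hs.2.trans_le hr.2⟩).le)
    (fun s hs => hrmax ⟨hr.1.trans hs.1, hs.2⟩)
  have hbr : 0 < (t₀ / r) ^ (ρ - 1) - lam * (Real.Gamma ρ)⁻¹ * ((t₀ - r) ^ ρ / ρ) :=
    hsub ⟨hla.trans_le hr.1, hr.2⟩
  exact absurd (hlow.trans het₀) (not_le.2 (mul_pos her hbr))

/-! ### Bounds for the relaxation function -/

lemma relaxKernel_one (lam t : ℝ) : relaxKernel 1 lam t = relaxFun 1 lam t := by
  simp [relaxKernel, relaxFun]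

lemma integral_relaxKernel_mono {ρ lam a b : ℝ} (hρ : 0 < ρ) (hρ1 : ρ ≤ 1) (hlam : 0 ≤ lam)
    (ha : 0 ≤ a) (hab : a ≤ b) :
    ∫ s in (0 : ℝ)..a, relaxKernel ρ lam s ≤ ∫ s in (0 : ℝ)..b, relaxKernel ρ lam s := by
  rw [← intervalIntegral.integral_add_adjacent_intervals
    (intervalIntegrable_relaxKernel hρ lam 0 a) (intervalIntegrable_relaxKernel hρ lam a b)]
  have : 0 ≤ ∫ s in a..b, relaxKernel ρ lam s := by
    rw [intervalIntegral.integral_of_le hab]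
    exact setIntegral_nonneg measurableSet_Ioc fun s hs =>
      (relaxKernel_pos hρ hρ1 hlam (ha.trans_lt hs.1)).le
  linarith

lemma antitoneOn_relaxFun {ρ lam : ℝ} (hρ : 0 < ρ) (hρ1 : ρ ≤ 1) (hlam : 0 ≤ lam) :
    AntitoneOn (relaxFun ρ lam) (Ici 0) := fun a ha b hb hab => by
  have h := mul_le_mul_of_nonneg_left (integral_relaxKernel_mono hρ hρ1 hlam ha hab) hlam
  rw [mul_integral_relaxKernel hρ lam ha, mul_integral_relaxKernel hρ lam hb] at h
  linarith

lemma relaxFun_le_one {ρ lam t : ℝ} (hρ : 0 < ρ) (hρ1 : ρ ≤ 1) (hlam : 0 ≤ lam) (ht : 0 ≤ t) :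
    relaxFun ρ lam t ≤ 1 :=
  (antitoneOn_relaxFun hρ hρ1 hlam self_mem_Ici ht ht).trans_eq (relaxFun_zero hρ lam)

lemma relaxFun_nonneg {ρ lam t : ℝ} (hρ : 0 < ρ) (hρ1 : ρ ≤ 1) (hlam : 0 ≤ lam) (ht : 0 ≤ t) :
    0 ≤ relaxFun ρ lam t := by
  rcases ht.eq_or_lt with rfl | ht
  · rw [relaxFun_zero hρ]; exact zero_le_one
  rcases hρ1.eq_or_lt with rfl | hρ1'
  · exact relaxKernel_one lam t ▸ (relaxKernel_pos hρ hρ1 hlam ht).le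
  rw [← integral_rpow_mul_relaxKernel hρ hρ1' lam ht, intervalIntegral.integral_of_le ht.le]
  refine mul_nonneg (inv_nonneg.2 (Real.Gamma_pos_of_pos (by linarith)).le)
    (setIntegral_nonneg measurableSet_Ioc fun s hs => ?_)
  exact mul_nonneg (Real.rpow_nonneg (by linarith [hs.2]) _) (relaxKernel_pos hρ hρ1 hlam hs.1).le

lemma intervalIntegrable_sub_rpow {ρ : ℝ} (hρ : 0 < ρ) (t : ℝ) :
    IntervalIntegrable (fun s : ℝ => (t - s) ^ (ρ - 1)) volume 0 t := by
  have := (intervalIntegral.intervalIntegrable_rpow' (a := 0) (b := t)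
    (r := ρ - 1) (by linarith)).comp_sub_left t
  rw [sub_zero, sub_self] at this
  exact this.symm

lemma integral_sub_rpow {ρ : ℝ} (hρ : 0 < ρ) (t : ℝ) :
    ∫ s in (0 : ℝ)..t, (t - s) ^ (ρ - 1) = t ^ ρ / ρ := by
  rw [intervalIntegral.integral_comp_sub_left (fun s => s ^ (ρ - 1)) t, sub_self, sub_zero,
    integral_rpow (Or.inl (by linarith)), sub_add_cancel, Real.zero_rpow hρ.ne', sub_zero]

/-- Since `y` decreases, `1 - y(t) = λ I^ρ y(t) ≥ λ y(t) t ^ ρ / Γ(ρ + 1)`. -/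
lemma relaxFun_mul_le {ρ lam t : ℝ} (hρ : 0 < ρ) (hρ1 : ρ ≤ 1) (hlam : 0 ≤ lam) (ht : 0 < t) :
    lam * (t ^ ρ / ρ) * relaxFun ρ lam t ≤ Real.Gamma ρ * (1 - relaxFun ρ lam t) := by
  rw [← integral_rpow_mul_relaxFun hρ lam ht, ← integral_sub_rpow hρ t, mul_assoc,
    ← intervalIntegral.integral_mul_const]
  refine mul_le_mul_of_nonneg_left ?_ hlam
  refine intervalIntegral.integral_mono_on ht.le ((intervalIntegrable_sub_rpow hρ t).mul_const _)
    ((intervalIntegrable_sub_rpow hρ t).mul_continuousOn (continuous_relaxFun hρ lam).continuousOn)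
    fun s hs => ?_
  exact mul_le_mul_of_nonneg_left (antitoneOn_relaxFun hρ hρ1 hlam hs.1 ht.le hs.2)
    (Real.rpow_nonneg (by linarith [hs.2]) _)

lemma relaxFun_lt_one {ρ lam t : ℝ} (hρ : 0 < ρ) (hρ1 : ρ ≤ 1) (hlam : 0 < lam) (ht : 0 < t) :
    relaxFun ρ lam t < 1 := by
  have h := relaxFun_mul_le hρ hρ1 hlam.le ht
  have hG := Real.Gamma_pos_of_pos hρ
  have hp : 0 < lam * (t ^ ρ / ρ) := by positivity
  by_contra hcon
  nlinarith

lemma mul_relaxFun_le {ρ lam t : ℝ} (hρ : 0 < ρ) (hρ1 : ρ ≤ 1) (hlam : 0 ≤ lam) (ht : 0 < t) :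
    lam * relaxFun ρ lam t ≤ Real.Gamma ρ * ρ / t ^ ρ := by
  have h := relaxFun_mul_le hρ hρ1 hlam ht
  have hG := Real.Gamma_pos_of_pos hρ
  have hy := relaxFun_nonneg hρ hρ1 hlam ht.le
  have htp : 0 < t ^ ρ := by positivity
  have h1 : lam * (t ^ ρ / ρ) * relaxFun ρ lam t ≤ Real.Gamma ρ := by nlinarith
  rw [le_div_iff₀ htp]
  calc lam * relaxFun ρ lam t * t ^ ρ = lam * (t ^ ρ / ρ) * relaxFun ρ lam t * ρ := by
        field_simp
    _ ≤ Real.Gamma ρ * ρ := by gcongr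

/-- `λ ∫₀ᵀ y ≤ Γ(ρ) T ^ (1 - ρ)`, because `(T - s) ^ (ρ - 1) ≥ T ^ (ρ - 1)` in `λ I^ρ y ≤ 1`. -/
lemma mul_integral_relaxFun_le {ρ lam T : ℝ} (hρ : 0 < ρ) (hρ1 : ρ ≤ 1) (hlam : 0 ≤ lam)
    (hT : 0 < T) :
    lam * ∫ s in (0 : ℝ)..T, relaxFun ρ lam s ≤ Real.Gamma ρ / T ^ (ρ - 1) := by
  have hG := Real.Gamma_pos_of_pos hρ
  rw [le_div_iff₀ (Real.rpow_pos_of_pos hT _), mul_assoc, mul_comm (∫ s in _.._, _),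
    ← intervalIntegral.integral_const_mul]
  calc lam * ∫ s in (0 : ℝ)..T, T ^ (ρ - 1) * relaxFun ρ lam s
      ≤ lam * ∫ s in (0 : ℝ)..T, (T - s) ^ (ρ - 1) * relaxFun ρ lam s := by
        refine mul_le_mul_of_nonneg_left ?_ hlam
        refine intervalIntegral.integral_mono_on_of_le_Ioo hT.le
          ((continuous_relaxFun hρ lam).intervalIntegrable _ _ |>.const_mul _)
          ((intervalIntegrable_sub_rpow hρ T).mul_continuousOn
            (continuous_relaxFun hρ lam).continuousOn) fun s hs => ?_
        exact mul_le_mul_of_nonneg_right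
          (Real.rpow_le_rpow_of_nonpos (by linarith [hs.2]) (by linarith [hs.1]) (by linarith))
          (relaxFun_nonneg hρ hρ1 hlam hs.1.le)
    _ = Real.Gamma ρ * (1 - relaxFun ρ lam T) := integral_rpow_mul_relaxFun hρ lam hT
    _ ≤ Real.Gamma ρ := by nlinarith [relaxFun_nonneg hρ hρ1 hlam hT.le]

/-- `y` depends on `λ` and `t` only through `λ t ^ ρ`, so it also decreases in `λ`. -/
lemma relaxFun_anti_left {ρ lam lam' t : ℝ} (hρ : 0 < ρ) (hρ1 : ρ ≤ 1) (hlam : 0 ≤ lam)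
    (h : lam ≤ lam') (ht : 0 ≤ t) : relaxFun ρ lam' t ≤ relaxFun ρ lam t := by
  have key : ∀ l, 0 ≤ l → relaxFun ρ l t = relaxFun ρ 1 ((l * t ^ ρ) ^ ρ⁻¹) := fun l hl => by
    rw [relaxFun, relaxFun, Real.rpow_inv_rpow (by positivity) hρ.ne', neg_mul, neg_one_mul]
  rw [key lam hlam, key lam' (hlam.trans h)]
  refine antitoneOn_relaxFun hρ hρ1 zero_le_one (mem_Ici.2 ?_) (mem_Ici.2 ?_) ?_
  · positivity
  · have := hlam.trans h; positivity
  · gcongr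

/-! ### Truncated convolutions -/

section Conv

variable {E : Type*} [NormedAddCommGroup E] [NormedSpace ℝ E]

/-- The truncated convolution `(a * h)(t) = ∫₀ᵗ a(t - s) h(s) ds` of a scalar kernel with a
vector-valued function. -/
noncomputable def truncConv (a : ℝ → ℝ) (h : ℝ → E) (t : ℝ) : E :=
  ∫ s in (0 : ℝ)..t, a (t - s) • h s

lemma truncConv_eq_integral_comp_sub (a : ℝ → ℝ) (h : ℝ → E) (t : ℝ) :
    truncConv a h t = ∫ s in (0 : ℝ)..t, a s • h (t - s) := by
  have := intervalIntegral.integral_comp_sub_left (a := 0) (b := t)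
    (fun s => a s • h (t - s)) t
  simpa [truncConv] using this

lemma truncConv_comm (a b : ℝ → ℝ) (t : ℝ) : truncConv a b t = truncConv b a t := by
  rw [truncConv_eq_integral_comp_sub, truncConv]
  simp only [smul_eq_mul, mul_comm]

lemma truncConv_congr {a a' : ℝ → ℝ} {h h' : ℝ → E} {t : ℝ} (ht : 0 ≤ t)
    (ha : ∀ s ∈ Ioo 0 t, a s = a' s) (hh : ∀ s ∈ Ioo 0 t, h s = h' s) :
    truncConv a h t = truncConv a' h' t := by
  rw [truncConv, truncConv, intervalIntegral.integral_of_le ht, intervalIntegral.integral_of_le ht,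
    integral_Ioc_eq_integral_Ioo, integral_Ioc_eq_integral_Ioo]
  refine setIntegral_congr_fun measurableSet_Ioo fun s hs => ?_
  rw [ha (t - s) ⟨by linarith [hs.2], by linarith [hs.1]⟩, hh s hs]

lemma truncConv_one (h : ℝ → E) (t : ℝ) :
    truncConv (fun _ => 1) h t = ∫ s in (0 : ℝ)..t, h s := by
  simp [truncConv]

open ContinuousLinearMap in
/-- The full convolution of functions that vanish on `(-∞, 0]` is the truncated one. -/
lemma convolution_eq_truncConv {P : ℝ → ℝ} {Q : ℝ → E} {t : ℝ} (ht : 0 ≤ t)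
    (hP : ∀ s ≤ 0, P s = 0) (hQ : ∀ s ≤ 0, Q s = 0) :
    convolution P Q (lsmul ℝ ℝ) volume t = truncConv P Q t := by
  rw [convolution_eq_swap, truncConv, intervalIntegral.integral_of_le ht]
  refine (setIntegral_eq_integral_of_forall_compl_eq_zero fun s hs => ?_).symm
  rw [mem_Ioc, not_and_or, not_lt, not_le] at hs
  rcases hs with hs | hs
  · simp [hQ s hs]
  · simp [hP (t - s) (by linarith)]

open ContinuousLinearMap in
lemma convolution_eq_zero_of_nonpos {P : ℝ → ℝ} {Q : ℝ → E} {t : ℝ} (ht : t ≤ 0)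
    (hP : ∀ s ≤ 0, P s = 0) (hQ : ∀ s ≤ 0, Q s = 0) :
    convolution P Q (lsmul ℝ ℝ) volume t = 0 := by
  rw [convolution_eq_swap]
  refine integral_eq_zero_of_ae (Filter.Eventually.of_forall fun s => ?_)
  rcases le_total s 0 with hs | hs
  · simp [hQ s hs]
  · simp [hP (t - s) (by linarith)]

open ContinuousLinearMap in
/-- Associativity of the truncated convolution for integrable kernels. -/
lemma truncConv_truncConv [CompleteSpace E] {T : ℝ} {a b : ℝ → ℝ} {h : ℝ → E}
    (ha : IntegrableOn a (Ioc 0 T)) (hb : IntegrableOn b (Ioc 0 T))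
    (hh : ContinuousOn h (Icc 0 T)) {t : ℝ} (ht : t ∈ Icc 0 T) :
    truncConv a (truncConv b h) t = truncConv (truncConv a b) h t := by
  set P := indicator (Ioc 0 T) a with hPdef
  set Q := indicator (Ioc 0 T) b with hQdef
  set R := indicator (Ioc 0 T) h with hRdef
  have hPi : Integrable P := ha.integrable_indicator measurableSet_Ioc
  have hQi : Integrable Q := hb.integrable_indicator measurableSet_Ioc
  have hRi : Integrable R := ((hh.integrableOn_Icc).mono_set Ioc_subset_Icc_self).integrable_indicator
    measurableSet_Ioc
  have hP : ∀ s ≤ 0, P s = 0 := fun s hs => indicator_of_notMem (fun h => absurd h.1 hs.not_gt) _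
  have hQ : ∀ s ≤ 0, Q s = 0 := fun s hs => indicator_of_notMem (fun h => absurd h.1 hs.not_gt) _
  have hR : ∀ s ≤ 0, R s = 0 := fun s hs => indicator_of_notMem (fun h => absurd h.1 hs.not_gt) _
  have hPe : ∀ s ∈ Ioc 0 T, P s = a s := fun s hs => indicator_of_mem hs _
  have hQe : ∀ s ∈ Ioc 0 T, Q s = b s := fun s hs => indicator_of_mem hs _
  have hRe : ∀ s ∈ Ioc 0 T, R s = h s := fun s hs => indicator_of_mem hs _
  obtain ⟨M, hM⟩ := isCompact_Icc.exists_bound_of_continuousOn hh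
  have hRb : ∀ s, ‖R s‖ ≤ max M 0 := fun s => by
    by_cases hs : s ∈ Ioc 0 T
    · rw [hRe s hs]; exact (hM s (Ioc_subset_Icc_self hs)).trans (le_max_left _ _)
    · rw [hRdef, indicator_of_notMem hs, norm_zero]; exact le_max_right _ _
  have hexQR : ∀ x, ConvolutionExistsAt (fun x => ‖Q x‖) (fun x => ‖R x‖) x (mul ℝ ℝ) volume := by
    intro x
    refine Integrable.mul_bdd (c := max M 0) hQi.norm ?_ (Filter.Eventually.of_forall fun s => ?_)
    · exact (hRi.norm.comp_sub_left x).aestronglyMeasurable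
    · rw [norm_norm]; exact hRb _
  have hQR : Integrable (convolution (fun x => ‖Q x‖) (fun x => ‖R x‖) (mul ℝ ℝ) volume) :=
    hQi.norm.integrable_convolution (mul ℝ ℝ) hRi.norm
  have hQRb : ∀ x, ‖convolution (fun x => ‖Q x‖) (fun x => ‖R x‖) (mul ℝ ℝ) volume x‖
      ≤ (∫ s, ‖Q s‖) * max M 0 := fun x => by
    rw [← integral_mul_const]
    refine norm_integral_le_of_norm_le (hQi.norm.mul_const _)
      (Filter.Eventually.of_forall fun s => ?_)
    simp only [mul_apply', norm_mul, norm_norm]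
    exact mul_le_mul_of_nonneg_left (hRb _) (norm_nonneg _)
  have key := convolution_assoc (μ := volume) (ν := volume) (lsmul ℝ ℝ) (lsmul ℝ ℝ) (lsmul ℝ ℝ)
    (lsmul ℝ ℝ) (f := P) (g := Q) (k := R) (x₀ := t) (fun x y z => smul_assoc x y z)
    hPi.aestronglyMeasurable hQi.aestronglyMeasurable hRi.aestronglyMeasurable
    (hPi.ae_convolution_exists _ hQi) (Filter.Eventually.of_forall hexQR)
    (by
      refine Integrable.mul_bdd (c := (∫ s, ‖Q s‖) * max M 0) hPi.norm
        (hQR.comp_sub_left t).aestronglyMeasurable (Filter.Eventually.of_forall fun s => hQRb _))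
  have hPQ0 := fun s (hs : s ≤ 0) => convolution_eq_zero_of_nonpos hs hP hQ
  have hQR0 := fun s (hs : s ≤ 0) => convolution_eq_zero_of_nonpos hs hQ hR
  have hmem : ∀ {s r : ℝ}, s ∈ Ioo 0 t → r ∈ Ioo 0 s → r ∈ Ioc 0 T := fun hs hr =>
    ⟨hr.1, (hr.2.trans hs.2).le.trans ht.2⟩
  have hmem' : ∀ {s : ℝ}, s ∈ Ioo 0 t → s ∈ Ioc 0 T := fun hs => ⟨hs.1, hs.2.le.trans ht.2⟩
  rw [convolution_eq_truncConv ht.1 hPQ0 hR, convolution_eq_truncConv ht.1 hP hQR0] at key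
  rw [← truncConv_congr ht.1 (fun s hs => hPe s (hmem' hs)) (fun s hs => ?_), ← key]
  · refine truncConv_congr ht.1 (fun s hs => ?_) (fun s hs => hRe s (hmem' hs))
    rw [convolution_eq_truncConv hs.1.le hP hQ]
    exact truncConv_congr hs.1.le (fun r hr => hPe r (hmem hs hr)) (fun r hr => hQe r (hmem hs hr))
  · rw [convolution_eq_truncConv hs.1.le hQ hR]
    exact truncConv_congr hs.1.le (fun r hr => hQe r (hmem hs hr)) (fun r hr => hRe r (hmem hs hr))

lemma continuousOn_truncConv [CompleteSpace E] {T : ℝ} {a : ℝ → ℝ} {h : ℝ → E} (hT : 0 ≤ T)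
    (ha : IntervalIntegrable a volume 0 T) (hh : ContinuousOn h (Icc 0 T)) :
    ContinuousOn (truncConv a h) (Icc 0 T) := by
  -- extend `h` continuously by constants; the part of the integral over `[t, T]` is then explicit
  set h' : ℝ → E := IccExtend hT ((Icc 0 T).domRestrict h) with hh'
  have hc : Continuous h' := (continuousOn_iff_continuous_domRestrict.1 hh).Icc_extend'
  have he : ∀ s ∈ Icc 0 T, h' s = h s := fun s hs => by rw [hh', IccExtend_of_mem hT _ hs]; rfl
  obtain ⟨M, hM⟩ := isCompact_Icc.exists_bound_of_continuousOn hh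
  have hb : ∀ s, ‖h' s‖ ≤ M := fun s => hM _ (projIcc 0 T hT s).2
  have h1 : Continuous fun t => ∫ s in (0 : ℝ)..T, a s • h' (t - s) := by
    refine intervalIntegral.continuous_of_dominated_interval (bound := fun s => ‖a s‖ * M)
      (fun t => ?_) (fun t => Filter.Eventually.of_forall fun s _ => ?_) (ha.norm.mul_const _)
      (Filter.Eventually.of_forall fun s _ => by fun_prop)
    · exact ((intervalIntegrable_iff.1 ha).aestronglyMeasurable).smul
        (by fun_prop : Continuous fun s => h' (t - s)).aestronglyMeasurable
    · rw [norm_smul]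
      exact mul_le_mul_of_nonneg_left (hb _) (norm_nonneg _)
  have h2 : ContinuousOn (fun t => (∫ s in (0 : ℝ)..t, a s)) (Icc 0 T) := by
    have := intervalIntegral.continuousOn_primitive_interval ((intervalIntegrable_iff' (by finiteness)).1 ha)
    rwa [uIcc_of_le hT] at this
  have h3 : ContinuousOn (fun t => (∫ s in (0 : ℝ)..T, a s • h' (t - s))
      - ((∫ s in (0 : ℝ)..T, a s) - ∫ s in (0 : ℝ)..t, a s) • h 0) (Icc 0 T) :=
    h1.continuousOn.sub ((continuousOn_const.sub h2).smul continuousOn_const)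
  refine h3.congr fun t ht => ?_
  have hi1 : IntervalIntegrable a volume 0 t := ha.mono_set (by
    rw [uIcc_of_le hT, uIcc_of_le ht.1]; exact Icc_subset_Icc_right ht.2)
  have hi2 : IntervalIntegrable a volume t T := ha.mono_set (by
    rw [uIcc_of_le hT, uIcc_of_le ht.2]; exact Icc_subset_Icc_left ht.1)
  have hct : Continuous fun s => h' (t - s) := by fun_prop
  simp only
  rw [← intervalIntegral.integral_add_adjacent_intervals hi1 hi2,
    ← intervalIntegral.integral_add_adjacent_intervals (hi1.smul_continuousOn hct.continuousOn)
      (hi2.smul_continuousOn hct.continuousOn), truncConv_eq_integral_comp_sub, add_sub_cancel_left,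
    ← intervalIntegral.integral_smul_const, add_sub_assoc]
  have e1 : ∫ s in (0 : ℝ)..t, a s • h (t - s) = ∫ s in (0 : ℝ)..t, a s • h' (t - s) := by
    refine intervalIntegral.integral_congr fun s hs => ?_
    rw [uIcc_of_le ht.1] at hs
    rw [he _ ⟨by linarith [hs.2], by linarith [hs.1, ht.2]⟩]
  have e2 : ∫ s in t..T, a s • h' (t - s) = ∫ s in t..T, a s • h 0 := by
    refine intervalIntegral.integral_congr fun s hs => ?_
    rw [uIcc_of_le ht.2] at hs
    rw [hh', IccExtend_of_le_left hT _ (by linarith [hs.1] : t - s ≤ 0)]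
    rfl
  rw [e1, e2, sub_self, add_zero]

lemma intervalIntegrable_comp_sub_smul {T t : ℝ} {a : ℝ → ℝ} {h : ℝ → E}
    (ha : IntervalIntegrable a volume 0 T) (hh : ContinuousOn h (Icc 0 T)) (ht : t ∈ Icc 0 T) :
    IntervalIntegrable (fun s => a (t - s) • h s) volume 0 t := by
  have h1 := (ha.mono_set (c := 0) (d := t) (by
    rw [uIcc_of_le (ht.1.trans ht.2), uIcc_of_le ht.1]
    exact Icc_subset_Icc_right ht.2)).comp_sub_left t
  rw [sub_zero, sub_self] at h1
  refine h1.symm.smul_continuousOn (hh.mono ?_)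
  rw [uIcc_of_le ht.1]; exact Icc_subset_Icc_right ht.2

lemma truncConv_sub {T t : ℝ} {a : ℝ → ℝ} {h h' : ℝ → E}
    (ha : IntervalIntegrable a volume 0 T) (hh : ContinuousOn h (Icc 0 T))
    (hh' : ContinuousOn h' (Icc 0 T)) (ht : t ∈ Icc 0 T) :
    truncConv a (fun s => h s - h' s) t = truncConv a h t - truncConv a h' t := by
  simp only [truncConv, smul_sub]
  exact intervalIntegral.integral_sub (intervalIntegrable_comp_sub_smul ha hh ht)
    (intervalIntegrable_comp_sub_smul ha hh' ht)

lemma truncConv_const [CompleteSpace E] (a : ℝ → ℝ) (c : E) (t : ℝ) :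
    truncConv a (fun _ => c) t = (∫ s in (0 : ℝ)..t, a s) • c := by
  rw [truncConv_eq_integral_comp_sub, intervalIntegral.integral_smul_const]

end Conv

/-! ### The scalar Cauchy problem -/

section Scalar

variable {E : Type*} [NormedAddCommGroup E] [NormedSpace ℝ E]

lemma fracIntegral_zero (w : ℝ → E) : fracIntegral 0 w = w := by
  funext t; simp [fracIntegral]

lemma fracIntegral_eq_truncConv {α : ℝ} (hα : α ≠ 0) (w : ℝ → E) :
    fracIntegral α w = truncConv (fun s => (Real.Gamma α)⁻¹ * s ^ (α - 1)) w := by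
  funext t
  simp only [fracIntegral, if_neg hα, truncConv, mul_smul, intervalIntegral.integral_smul]

lemma intervalIntegrable_fracKernel {α : ℝ} (hα : 0 < α) (a b : ℝ) :
    IntervalIntegrable (fun s : ℝ => (Real.Gamma α)⁻¹ * s ^ (α - 1)) volume a b :=
  (intervalIntegral.intervalIntegrable_rpow' (by linarith)).const_mul _

lemma continuousOn_fracIntegral [CompleteSpace E] {α T : ℝ} {w : ℝ → E} (hα : 0 ≤ α) (hT : 0 ≤ T)
    (hw : ContinuousOn w (Icc 0 T)) : ContinuousOn (fracIntegral α w) (Icc 0 T) := by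
  rcases hα.eq_or_lt with rfl | hα
  · rwa [fracIntegral_zero]
  · rw [fracIntegral_eq_truncConv hα.ne']
    exact continuousOn_truncConv hT (intervalIntegrable_fracKernel hα 0 T) hw

/-- `I^{1-ρ} (e * h) = y * h`. -/
lemma fracIntegral_truncConv_relaxKernel [CompleteSpace E] {ρ T : ℝ} {h : ℝ → E}
    (hρ : 0 < ρ) (hρ1 : ρ ≤ 1) (lam : ℝ) (hh : ContinuousOn h (Icc 0 T)) {t : ℝ}
    (ht : t ∈ Icc 0 T) :
    fracIntegral (1 - ρ) (truncConv (relaxKernel ρ lam) h) t = truncConv (relaxFun ρ lam) h t := by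
  rcases hρ1.eq_or_lt with rfl | hρ1
  · rw [sub_self, fracIntegral_zero, funext (relaxKernel_one lam)]
  · rw [fracIntegral_eq_truncConv (sub_pos.2 hρ1).ne',
      truncConv_truncConv (intervalIntegrable_fracKernel (sub_pos.2 hρ1) 0 T).1
        (intervalIntegrable_relaxKernel hρ lam 0 T).1 hh ht]
    refine truncConv_congr ht.1 (fun s hs => ?_) fun _ _ => rfl
    rw [← integral_rpow_mul_relaxKernel hρ hρ1 lam hs.1, truncConv,
      ← intervalIntegral.integral_const_mul]
    simp only [smul_eq_mul, mul_assoc]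

/-- `e * I^{1-ρ} w = y * w`. -/
lemma truncConv_relaxKernel_fracIntegral [CompleteSpace E] {ρ T : ℝ} {w : ℝ → E}
    (hρ : 0 < ρ) (hρ1 : ρ ≤ 1) (lam : ℝ) (hw : ContinuousOn w (Icc 0 T)) {t : ℝ}
    (ht : t ∈ Icc 0 T) :
    truncConv (relaxKernel ρ lam) (fracIntegral (1 - ρ) w) t = truncConv (relaxFun ρ lam) w t := by
  rcases hρ1.eq_or_lt with rfl | hρ1
  · rw [sub_self, fracIntegral_zero, funext (relaxKernel_one lam)]
  · rw [fracIntegral_eq_truncConv (sub_pos.2 hρ1).ne',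
      truncConv_truncConv (intervalIntegrable_relaxKernel hρ lam 0 T).1
        (intervalIntegrable_fracKernel (sub_pos.2 hρ1) 0 T).1 hw ht]
    refine truncConv_congr ht.1 (fun s hs => ?_) fun _ _ => rfl
    rw [truncConv_comm, ← integral_rpow_mul_relaxKernel hρ hρ1 lam hs.1, truncConv,
      ← intervalIntegral.integral_const_mul]
    simp only [smul_eq_mul, mul_assoc]

/-- `∫ (e * h) = (∫ e) * h`. -/
lemma integral_truncConv_relaxKernel [CompleteSpace E] {ρ T : ℝ} {h : ℝ → E}
    (hρ : 0 < ρ) (lam : ℝ) (hh : ContinuousOn h (Icc 0 T)) {t : ℝ} (ht : t ∈ Icc 0 T) :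
    ∫ s in (0 : ℝ)..t, truncConv (relaxKernel ρ lam) h s
      = truncConv (fun r => ∫ s in (0 : ℝ)..r, relaxKernel ρ lam s) h t := by
  rw [← truncConv_one, truncConv_truncConv (T := T) (by simp)
    (intervalIntegrable_relaxKernel hρ lam 0 T).1 hh ht, funext (truncConv_one (relaxKernel ρ lam))]

/-- `y * h = ∫ h - λ ∫ (e * h)`. -/
lemma truncConv_relaxFun [CompleteSpace E] {ρ T : ℝ} {h : ℝ → E}
    (hρ : 0 < ρ) (lam : ℝ) (hh : ContinuousOn h (Icc 0 T)) {t : ℝ} (ht : t ∈ Icc 0 T) :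
    truncConv (relaxFun ρ lam) h t = (∫ s in (0 : ℝ)..t, h s)
      - lam • ∫ s in (0 : ℝ)..t, truncConv (relaxKernel ρ lam) h s := by
  have hht : ContinuousOn h (uIcc 0 t) :=
    hh.mono (by rw [uIcc_of_le ht.1]; exact Icc_subset_Icc_right ht.2)
  rw [integral_truncConv_relaxKernel hρ lam hh ht, eq_sub_iff_add_eq, eq_comm, ← truncConv_one,
    truncConv, truncConv, truncConv, ← intervalIntegral.integral_smul,
    ← intervalIntegral.integral_add]
  · refine intervalIntegral.integral_congr fun s hs => ?_
    rw [uIcc_of_le ht.1] at hs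
    simp only [smul_smul]
    rw [← add_smul, mul_integral_relaxKernel hρ lam (by linarith [hs.2]), add_sub_cancel]
  · exact (((continuous_relaxFun hρ lam).comp
      (continuous_const.sub continuous_id)).continuousOn.smul hht).intervalIntegrable
  · refine (ContinuousOn.const_smul (ContinuousOn.smul ?_ hht) lam).intervalIntegrable
    exact ((intervalIntegral.continuous_primitive
      (fun a b => intervalIntegrable_relaxKernel hρ lam a b) 0).comp
        (continuous_const.sub continuous_id)).continuousOn

lemma hasDerivWithinAt_integral_Icc [CompleteSpace E] {δ T : ℝ} {G : ℝ → E}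
    (hG : ContinuousOn G (Icc δ T)) {t : ℝ} (ht : t ∈ Icc δ T) :
    HasDerivWithinAt (fun s => ∫ r in δ..s, G r) (G t) (Icc δ T) t := by
  have hδT : δ ≤ T := ht.1.trans ht.2
  set G' := IccExtend hδT ((Icc δ T).domRestrict G) with hG'
  have hc : Continuous G' := (continuousOn_iff_continuous_domRestrict.1 hG).Icc_extend'
  have he : ∀ s ∈ Icc δ T, G' s = G s := fun s hs => by rw [hG', IccExtend_of_mem _ _ hs]; rfl
  have hd := (hc.integral_hasStrictDerivAt δ t).hasDerivAt.hasDerivWithinAt (s := Icc δ T)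
  rw [he t ht] at hd
  have hcongr : ∀ s ∈ Icc δ T, ∫ r in δ..s, G r = ∫ r in δ..s, G' r := fun s hs => by
    refine intervalIntegral.integral_congr fun r hr => ?_
    rw [uIcc_of_le hs.1] at hr
    exact (he r ⟨hr.1, hr.2.trans hs.2⟩).symm
  exact hd.congr hcongr (hcongr t ht)

lemma eqOn_of_integral_eq [CompleteSpace E] {T : ℝ} {F G : ℝ → E} (hT : 0 < T)
    (hF : ContinuousOn F (Icc 0 T)) (hG : ContinuousOn G (Icc 0 T))
    (h : ∀ t ∈ Icc 0 T, ∫ s in (0 : ℝ)..t, F s = ∫ s in (0 : ℝ)..t, G s) :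
    EqOn F G (Icc 0 T) := fun t ht =>
  (uniqueDiffOn_Icc hT t ht).eq_deriv _ (hasDerivWithinAt_integral_Icc hF ht)
    ((hasDerivWithinAt_integral_Icc hG ht).congr h (h t ht))

/-- `w = e * h` solves `I^{1-ρ} w = ∫ (h - λ w)`. -/
lemma fracIntegral_truncConv_eq_integral [CompleteSpace E] {ρ T : ℝ} {h : ℝ → E}
    (hρ : 0 < ρ) (hρ1 : ρ ≤ 1) (lam : ℝ) (hT : 0 ≤ T) (hh : ContinuousOn h (Icc 0 T)) {t : ℝ}
    (ht : t ∈ Icc 0 T) :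
    fracIntegral (1 - ρ) (truncConv (relaxKernel ρ lam) h) t
      = ∫ s in (0 : ℝ)..t, (h s - lam • truncConv (relaxKernel ρ lam) h s) := by
  have hsub : uIcc 0 t ⊆ Icc 0 T := by rw [uIcc_of_le ht.1]; exact Icc_subset_Icc_right ht.2
  rw [fracIntegral_truncConv_relaxKernel hρ hρ1 lam hh ht, truncConv_relaxFun hρ lam hh ht,
    intervalIntegral.integral_sub, intervalIntegral.integral_smul]
  · exact (hh.mono hsub).intervalIntegrable
  · exact ((continuousOn_truncConv hT (intervalIntegrable_relaxKernel hρ lam 0 T) hh).mono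
      hsub).const_smul lam |>.intervalIntegrable

/-- `w = e * h` is the only continuous solution of `I^{1-ρ} w = ∫ (h - λ w)`: convolution with `e`
turns the equation into `∫ w = ∫ (e * h)`. -/
lemma eqOn_truncConv_of_fracIntegral_eq [CompleteSpace E] {ρ T lam : ℝ} {w h : ℝ → E}
    (hρ : 0 < ρ) (hρ1 : ρ ≤ 1) (hT : 0 < T) (hw : ContinuousOn w (Icc 0 T))
    (hh : ContinuousOn h (Icc 0 T))
    (heq : ∀ t ∈ Icc 0 T, fracIntegral (1 - ρ) w t = ∫ s in (0 : ℝ)..t, (h s - lam • w s)) :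
    EqOn w (truncConv (relaxKernel ρ lam) h) (Icc 0 T) := by
  have hek := intervalIntegrable_relaxKernel hρ lam 0 T
  have hlw : ContinuousOn (fun s => lam • w s) (Icc 0 T) := hw.const_smul lam
  have hhw : ContinuousOn (fun s => h s - lam • w s) (Icc 0 T) := hh.sub hlw
  have heh := continuousOn_truncConv hT.le hek hh
  refine eqOn_of_integral_eq hT hw heh fun t ht => ?_
  have hsub : uIcc 0 t ⊆ Icc 0 T := by rw [uIcc_of_le ht.1]; exact Icc_subset_Icc_right ht.2
  have h1 := truncConv_relaxKernel_fracIntegral hρ hρ1 lam hw ht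
  rw [truncConv_congr ht.1 (fun _ _ => rfl) fun s hs => heq s ⟨hs.1.le, hs.2.le.trans ht.2⟩,
    ← funext (truncConv_one fun s => h s - lam • w s),
    truncConv_truncConv hek.1 (by simp) hhw ht,
    funext (truncConv_comm (relaxKernel ρ lam) fun _ => 1),
    ← truncConv_truncConv (by simp) hek.1 hhw ht, truncConv_one,
    truncConv_relaxFun hρ lam hw ht] at h1
  have h2 : ∫ s in (0 : ℝ)..t, truncConv (relaxKernel ρ lam) (fun s => h s - lam • w s) s
      = (∫ s in (0 : ℝ)..t, truncConv (relaxKernel ρ lam) h s)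
        - lam • ∫ s in (0 : ℝ)..t, truncConv (relaxKernel ρ lam) w s := by
    rw [← intervalIntegral.integral_smul, ← intervalIntegral.integral_sub]
    · refine intervalIntegral.integral_congr fun s hs => ?_
      rw [truncConv_sub hek hh hlw (hsub hs)]
      congr 1
      simp only [truncConv, smul_comm _ lam, intervalIntegral.integral_smul]
    · exact (heh.mono hsub).intervalIntegrable
    · exact ((continuousOn_truncConv hT.le hek hw).mono hsub).const_smul lam |>.intervalIntegrable
  rw [h2] at h1
  exact (sub_left_injective h1).symm

/-- Integrated form of a Caputo equation whose right-hand side is continuous up to `0`. -/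
lemma HasCaputoDerivOn.fracIntegral_eq_integral [CompleteSpace E] {ρ T : ℝ} {y w G : ℝ → E}
    (hρ1 : ρ ≤ 1) (hT : 0 ≤ T) (hy : ContinuousOn y (Icc 0 T)) (h : HasCaputoDerivOn ρ T y w)
    (hG : ContinuousOn G (Icc 0 T)) (hwG : ∀ t ∈ Ioc 0 T, w t = G t) {t : ℝ} (ht : t ∈ Icc 0 T) :
    fracIntegral (1 - ρ) (fun s => y s - y 0) t = ∫ s in (0 : ℝ)..t, G s := by
  have hyc : ContinuousOn (fun s => y s - y 0) (Icc 0 T) := hy.sub continuousOn_const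
  have hc := continuousOn_fracIntegral (α := 1 - ρ) (by linarith) hT hyc
  have hsub : Icc 0 t ⊆ Icc 0 T := Icc_subset_Icc_right ht.2
  have h0 : fracIntegral (1 - ρ) (fun s => y s - y 0) 0 = 0 := by
    simp [fracIntegral]
  rw [intervalIntegral.integral_eq_sub_of_hasDerivAt_of_le ht.1 (hc.mono hsub), h0, sub_zero]
  · intro s hs
    have hsT : s ∈ Ioo 0 T := ⟨hs.1, hs.2.trans_le ht.2⟩
    rw [← hwG s ⟨hsT.1, hsT.2.le⟩]
    exact (h s ⟨hsT.1, hsT.2.le⟩).hasDerivAt (Icc_mem_nhds hsT.1 hsT.2)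
  · exact (hG.mono (by rwa [uIcc_of_le ht.1])).intervalIntegrable

/-! ### The coefficients `q` and `p` -/

lemma qCoeff_eq_truncConv (g : ℝ → ℝ) (ρ lam t : ℝ) :
    qCoeff g ρ lam t = truncConv (relaxKernel ρ lam) g t := rfl

lemma pCoeff_eq_truncConv {g : ℝ → ℝ} {ρ t : ℝ} (hρ : 0 < ρ) (lam : ℝ) (ht : 0 ≤ t) :
    pCoeff g ρ lam t = truncConv (fun r => ∫ s in (0 : ℝ)..r, relaxKernel ρ lam s) g t := by
  refine intervalIntegral.integral_congr fun s hs => ?_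
  rw [uIcc_of_le ht] at hs
  simp only [smul_eq_mul]
  rw [integral_relaxKernel_eq hρ lam (by linarith [hs.2])]
  ring

lemma continuousOn_qCoeff {g : ℝ → ℝ} {ρ T : ℝ} (hρ : 0 < ρ) (lam : ℝ) (hT : 0 ≤ T)
    (hg : ContinuousOn g (Icc 0 T)) : ContinuousOn (qCoeff g ρ lam) (Icc 0 T) :=
  continuousOn_truncConv hT (intervalIntegrable_relaxKernel hρ lam 0 T) hg

lemma integral_qCoeff {g : ℝ → ℝ} {ρ T : ℝ} (hρ : 0 < ρ) (lam : ℝ) (hT : 0 ≤ T)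
    (hg : ContinuousOn g (Icc 0 T)) :
    ∫ t in (0 : ℝ)..T, qCoeff g ρ lam t = pCoeff g ρ lam T := by
  rw [pCoeff_eq_truncConv hρ lam hT,
    ← integral_truncConv_relaxKernel hρ lam hg (right_mem_Icc.2 hT)]
  rfl

/-- The convolution of `e` with `g a - λ φ`, the inhomogeneity in the equation satisfied by
`u - φ` when `D_t^ρ u + λ u = g a`, `u(0) = φ`. -/
lemma truncConv_relaxKernel_source [CompleteSpace E] {g : ℝ → ℝ} {ρ T t : ℝ} (hρ : 0 < ρ)
    (lam : ℝ) (hg : ContinuousOn g (Icc 0 T)) (a φ : E) (ht : t ∈ Icc 0 T) :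
    truncConv (relaxKernel ρ lam) (fun s => g s • a - lam • φ) t
      = qCoeff g ρ lam t • a + relaxFun ρ lam t • φ - φ := by
  have hga : ContinuousOn (fun s => g s • a) (Icc 0 T) := hg.smul continuousOn_const
  rw [truncConv_sub (intervalIntegrable_relaxKernel hρ lam 0 T) hga continuousOn_const ht,
    truncConv_const, smul_smul,
    mul_comm, mul_integral_relaxKernel hρ lam ht.1, sub_smul, one_smul, add_sub_assoc,
    ← neg_sub (relaxFun ρ lam t • φ) φ, sub_neg_eq_add, qCoeff_eq_truncConv]
  congr 1
  simp only [truncConv, smul_smul, smul_eq_mul]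
  exact intervalIntegral.integral_smul_const _ _

/-- The scalar Cauchy problem `D_t^ρ y + λ y = g a` has at most the solution
`y(0) E_{ρ,1}(-λ t ^ ρ) + q(t) a`. -/
lemma HasCaputoDerivOn.eq_of_add_smul_eq [CompleteSpace E] {ρ T lam : ℝ} {g : ℝ → ℝ}
    {y w : ℝ → E} {a : E} (hρ : 0 < ρ) (hρ1 : ρ ≤ 1) (hT : 0 < T)
    (hg : ContinuousOn g (Icc 0 T)) (hy : ContinuousOn y (Icc 0 T))
    (h : HasCaputoDerivOn ρ T y w) (heq : ∀ t ∈ Ioc 0 T, w t + lam • y t = g t • a)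
    {t : ℝ} (ht : t ∈ Icc 0 T) :
    y t = relaxFun ρ lam t • y 0 + qCoeff g ρ lam t • a := by
  have hga : ContinuousOn (fun s => g s • a) (Icc 0 T) := hg.smul continuousOn_const
  have hh : ContinuousOn (fun s => g s • a - lam • y 0) (Icc 0 T) := hga.sub continuousOn_const
  have hw : ContinuousOn (fun s => y s - y 0) (Icc 0 T) := hy.sub continuousOn_const
  have key := eqOn_truncConv_of_fracIntegral_eq (lam := lam) hρ hρ1 hT hw hh (fun t ht => ?_) ht
  · rw [truncConv_relaxKernel_source hρ lam hg a (y 0) ht] at key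
    simp only at key
    rw [sub_left_inj] at key
    rw [key, add_comm]
  · rw [h.fracIntegral_eq_integral (G := fun s => g s • a - lam • y s) hρ1 hT.le hy
      (hga.sub (hy.const_smul lam)) (fun t ht => eq_sub_of_add_eq (heq t ht)) ht]
    refine intervalIntegral.integral_congr fun s _ => ?_
    simp only [smul_sub]
    abel

/-- The function `φ E_{ρ,1}(-λ t ^ ρ) + q(t) a` solves the integrated scalar equation. -/
lemma fracIntegral_relaxFun_add_qCoeff [CompleteSpace E] {ρ T : ℝ} {g : ℝ → ℝ} (hρ : 0 < ρ)
    (hρ1 : ρ ≤ 1) (lam : ℝ) (hT : 0 ≤ T) (hg : ContinuousOn g (Icc 0 T)) (a φ : E)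
    {t : ℝ} (ht : t ∈ Icc 0 T) :
    fracIntegral (1 - ρ) (fun s => relaxFun ρ lam s • φ + qCoeff g ρ lam s • a - φ) t
      = ∫ s in (0 : ℝ)..t,
        (g s • a - lam • (relaxFun ρ lam s • φ + qCoeff g ρ lam s • a)) := by
  have hh : ContinuousOn (fun s => g s • a - lam • φ) (Icc 0 T) :=
    (hg.smul continuousOn_const).sub continuousOn_const
  have hsub : Icc 0 t ⊆ Icc 0 T := Icc_subset_Icc_right ht.2
  have key := fracIntegral_truncConv_eq_integral hρ hρ1 lam hT hh ht
  have hcongr : ∀ s ∈ Icc 0 t, relaxFun ρ lam s • φ + qCoeff g ρ lam s • a - φ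
      = truncConv (relaxKernel ρ lam) (fun s => g s • a - lam • φ) s := fun s hs => by
    rw [truncConv_relaxKernel_source hρ lam hg a φ (hsub hs), add_comm (relaxFun ρ lam s • φ)]
  have hfrac : fracIntegral (1 - ρ) (fun s => relaxFun ρ lam s • φ + qCoeff g ρ lam s • a - φ) t
      = fracIntegral (1 - ρ) (truncConv (relaxKernel ρ lam) fun s => g s • a - lam • φ) t := by
    rw [fracIntegral, fracIntegral, hcongr t (right_mem_Icc.2 ht.1)]
    congr 2
    refine intervalIntegral.integral_congr fun s hs => ?_
    rw [uIcc_of_le ht.1] at hs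
    rw [hcongr s hs]
  rw [hfrac, key]
  refine intervalIntegral.integral_congr fun s hs => ?_
  rw [uIcc_of_le ht.1] at hs
  rw [← hcongr s hs, smul_sub]
  abel

end Scalar

/-- `λ |q(t)| ≤ sup |g|`, since `λ ∫ e = 1 - y ≤ 1`. -/
lemma mul_abs_qCoeff_le {g : ℝ → ℝ} {ρ lam T M t : ℝ} (hρ : 0 < ρ) (hρ1 : ρ ≤ 1)
    (hlam : 0 ≤ lam) (hM : ∀ s ∈ Icc 0 T, |g s| ≤ M) (ht : t ∈ Icc 0 T) :
    lam * |qCoeff g ρ lam t| ≤ M := by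
  have hM0 : 0 ≤ M := (abs_nonneg _).trans (hM t ht)
  have hi := (intervalIntegrable_relaxKernel hρ lam 0 t).comp_sub_left t
  rw [sub_zero, sub_self] at hi
  have h1 : |qCoeff g ρ lam t| ≤ ∫ s in (0 : ℝ)..t, relaxKernel ρ lam (t - s) * M := by
    rw [qCoeff, ← Real.norm_eq_abs]
    refine intervalIntegral.norm_integral_le_of_norm_le ht.1 ?_ (hi.symm.mul_const M)
    -- at `s = t` the kernel has the junk value of `0 ^ (ρ - 1)`, so this point is discarded
    have hne : ∀ᵐ s : ℝ, s ≠ t := by simp [ae_iff]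
    filter_upwards [hne] with s hst hs
    have he : 0 < relaxKernel ρ lam (t - s) :=
      relaxKernel_pos hρ hρ1 hlam (sub_pos.2 (lt_of_le_of_ne hs.2 hst))
    rw [Real.norm_eq_abs, ← relaxKernel, abs_mul, abs_of_pos he]
    exact mul_le_mul_of_nonneg_left (hM s ⟨hs.1.le, hs.2.trans ht.2⟩) he.le
  rw [intervalIntegral.integral_mul_const,
    intervalIntegral.integral_comp_sub_left (relaxKernel ρ lam) t, sub_self, sub_zero] at h1
  calc lam * |qCoeff g ρ lam t| ≤ lam * ((∫ s in (0 : ℝ)..t, relaxKernel ρ lam s) * M) := by gcongr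
    _ = (1 - relaxFun ρ lam t) * M := by rw [← mul_assoc, mul_integral_relaxKernel hρ lam ht.1]
    _ ≤ M := by nlinarith [relaxFun_nonneg hρ hρ1 hlam ht.1]

lemma mul_pCoeff {g : ℝ → ℝ} {ρ T : ℝ} (hρ : 0 < ρ) (lam : ℝ) (hT : 0 ≤ T) :
    lam * pCoeff g ρ lam T = ∫ s in (0 : ℝ)..T, (1 - relaxFun ρ lam (T - s)) * g s := by
  rw [pCoeff_eq_truncConv hρ lam hT, truncConv, ← intervalIntegral.integral_const_mul]
  refine intervalIntegral.integral_congr fun s hs => ?_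
  rw [uIcc_of_le hT] at hs
  simp only [smul_eq_mul]
  rw [← mul_assoc, mul_integral_relaxKernel hρ lam (by linarith [hs.2])]

lemma pCoeff_neg (g : ℝ → ℝ) (ρ lam t : ℝ) : pCoeff (fun s => -g s) ρ lam t = -pCoeff g ρ lam t := by
  simp [pCoeff, neg_mul]

lemma exists_pos_le_mul_pCoeff {g : ℝ → ℝ} {ρ T lam₀ : ℝ} (hρ : 0 < ρ) (hρ1 : ρ ≤ 1) (hT : 0 < T)
    (hlam₀ : 0 < lam₀) (hg : ContinuousOn g (Icc 0 T)) (hpos : ∀ t ∈ Icc 0 T, 0 < g t) :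
    ∃ c > 0, ∀ lam ≥ lam₀, c ≤ lam * pCoeff g ρ lam T := by
  have hc : ∀ lam, ContinuousOn (fun s => (1 - relaxFun ρ lam (T - s)) * g s) (Icc 0 T) :=
    fun lam => (continuous_const.sub ((continuous_relaxFun hρ lam).comp
      (continuous_const.sub continuous_id))).continuousOn.mul hg
  have hi : ∀ lam, IntervalIntegrable (fun s => (1 - relaxFun ρ lam (T - s)) * g s) volume 0 T :=
    fun lam => ContinuousOn.intervalIntegrable (by rw [uIcc_of_le hT.le]; exact hc lam)
  refine ⟨∫ s in (0 : ℝ)..T, (1 - relaxFun ρ lam₀ (T - s)) * g s, ?_, fun lam hlam => ?_⟩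
  · refine intervalIntegral.intervalIntegral_pos_of_pos_on (hi lam₀) (fun s hs => ?_) hT
    exact mul_pos (sub_pos.2 (relaxFun_lt_one hρ hρ1 hlam₀ (sub_pos.2 hs.2)))
      (hpos s ⟨hs.1.le, hs.2.le⟩)
  · rw [mul_pCoeff hρ lam hT.le]
    refine intervalIntegral.integral_mono_on hT.le (hi lam₀) (hi lam) fun s hs => ?_
    exact mul_le_mul_of_nonneg_right
      (sub_le_sub_left (relaxFun_anti_left hρ hρ1 hlam₀.le hlam (by linarith [hs.2])) 1)
      (hpos s hs).le

/-- If `g` has no zero, then `λ |p_λ(T)|` is bounded below for `λ` away from `0`. -/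
lemma exists_pos_le_mul_abs_pCoeff {g : ℝ → ℝ} {ρ T lam₀ : ℝ} (hρ : 0 < ρ) (hρ1 : ρ ≤ 1)
    (hT : 0 < T) (hlam₀ : 0 < lam₀) (hg : ContinuousOn g (Icc 0 T))
    (hg0 : ∀ t ∈ Icc 0 T, g t ≠ 0) :
    ∃ c > 0, ∀ lam ≥ lam₀, c ≤ lam * |pCoeff g ρ lam T| := by
  have hsign : (∀ t ∈ Icc 0 T, 0 < g t) ∨ ∀ t ∈ Icc 0 T, 0 < -g t := by
    by_contra! hcon
    obtain ⟨⟨a, ha, hga⟩, b, hb, hgb⟩ := hcon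
    obtain ⟨t, ht, ht0⟩ := isPreconnected_Icc.intermediate_value ha hb hg
      (⟨hga, by linarith⟩ : (0 : ℝ) ∈ Icc (g a) (g b))
    exact hg0 t ht ht0
  rcases hsign with h | h
  · obtain ⟨c, hc, hle⟩ := exists_pos_le_mul_pCoeff hρ hρ1 hT hlam₀ hg h
    exact ⟨c, hc, fun lam hlam => (hle lam hlam).trans
      (mul_le_mul_of_nonneg_left (le_abs_self _) (hlam₀.le.trans hlam))⟩
  · obtain ⟨c, hc, hle⟩ := exists_pos_le_mul_pCoeff hρ hρ1 hT hlam₀ hg.neg h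
    refine ⟨c, hc, fun lam hlam => (hle lam hlam).trans ?_⟩
    rw [← abs_neg]
    refine mul_le_mul_of_nonneg_left ?_ (hlam₀.le.trans hlam)
    exact (pCoeff_neg g ρ lam T).trans_le (le_abs_self _)

/-! ### Fractional derivatives under continuous linear maps -/

section Linear

variable {H E : Type*} [NormedAddCommGroup H] [NormedSpace ℝ H] [CompleteSpace H]
  [NormedAddCommGroup E] [NormedSpace ℝ E] [CompleteSpace E]

lemma ContinuousLinearMap.map_fracIntegral (L : H →L[ℝ] E) {α T t : ℝ} {w : ℝ → H} (hα : 0 ≤ α)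
    (hw : ContinuousOn w (Icc 0 T)) (ht : t ∈ Icc 0 T) :
    L (fracIntegral α w t) = fracIntegral α (fun s => L (w s)) t := by
  rcases hα.eq_or_lt with rfl | hα
  · simp only [fracIntegral_zero]
  · rw [fracIntegral_eq_truncConv hα.ne', fracIntegral_eq_truncConv hα.ne', truncConv, truncConv,
      ← L.intervalIntegral_comp_comm
        (intervalIntegrable_comp_sub_smul (intervalIntegrable_fracKernel hα 0 T) hw ht)]
    simp only [map_smul]

lemma HasCaputoDerivOn.clm_comp (L : H →L[ℝ] E) {ρ T : ℝ} {y w : ℝ → H} (hρ1 : ρ ≤ 1)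
    (hy : ContinuousOn y (Icc 0 T)) (h : HasCaputoDerivOn ρ T y w) :
    HasCaputoDerivOn ρ T (fun s => L (y s)) (fun s => L (w s)) := fun t ht => by
  have hyc : ContinuousOn (fun s => y s - y 0) (Icc 0 T) := hy.sub continuousOn_const
  have hcongr : ∀ s ∈ Icc 0 T, fracIntegral (1 - ρ) (fun s => L (y s) - L (y 0)) s
      = L (fracIntegral (1 - ρ) (fun s => y s - y 0) s) := fun s hs => by
    rw [L.map_fracIntegral (by linarith) hyc hs]
    simp only [map_sub]
  exact (L.hasFDerivAt.comp_hasDerivWithinAt t (h t ht)).congr hcongr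
    (hcongr t (Ioc_subset_Icc_self ht))

end Linear

/-! ### Expansions in a Hilbert basis -/

section Hilbert

variable {𝕜 H : Type*} [RCLike 𝕜] [NormedAddCommGroup H] [InnerProductSpace 𝕜 H]

/-- Any real normed space structure on a `𝕜`-normed space is the restriction of the `𝕜`-structure,
because additive continuous maps are `ℝ`-linear. -/
lemma isScalarTower_real [NormedSpace ℝ H] : IsScalarTower ℝ 𝕜 H where
  smul_assoc r c x := by
    let F : 𝕜 →+ H := (smulAddHom 𝕜 H).flip x
    have hF : ∀ d : 𝕜, F d = d • x := fun d => rfl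
    have hc : Continuous F := by
      simp only [show (F : 𝕜 → H) = fun d => d • x from rfl]
      fun_prop
    rw [← hF, ← hF, map_real_smul F hc]

lemma HilbertBasis.ext_inner (v : HilbertBasis ℕ 𝕜 H) {x y : H}
    (h : ∀ k, inner 𝕜 (v k) x = inner 𝕜 (v k) y) : x = y := by
  refine v.repr.injective (lp.ext (funext fun k => ?_))
  rw [v.repr_apply_apply, v.repr_apply_apply, h]

lemma HilbertBasis.hasSum_norm_inner_sq (v : HilbertBasis ℕ 𝕜 H) (x : H) :
    HasSum (fun k => ‖(inner 𝕜 (v k) x : 𝕜)‖ ^ 2) (‖x‖ ^ 2) := by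
  have h : HasSum (fun k => RCLike.re (inner 𝕜 x (v k) * inner 𝕜 (v k) x : 𝕜))
      (RCLike.re (inner 𝕜 x x : 𝕜)) :=
    (v.hasSum_inner_mul_inner x x).mapL (RCLike.reCLM (K := 𝕜))
  simpa only [inner_mul_symm_re_eq_norm, norm_mul, norm_inner_symm x, ← sq,
    inner_self_eq_norm_sq] using h

lemma HilbertBasis.hasSum_inner_smul (v : HilbertBasis ℕ 𝕜 H) (x : H) :
    HasSum (fun k => (inner 𝕜 (v k) x : 𝕜) • v k) x := by
  simpa only [v.repr_apply_apply] using v.hasSum_repr x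

/-- Riesz–Fischer. -/
lemma HilbertBasis.exists_inner_eq (v : HilbertBasis ℕ 𝕜 H) {c : ℕ → 𝕜}
    (hc : Summable fun k => ‖c k‖ ^ 2) : ∃ x : H, ∀ k, inner 𝕜 (v k) x = c k := by
  have hmem : Memℓp c 2 := by
    refine memℓp_gen ?_
    simpa using hc
  refine ⟨v.repr.symm ⟨c, hmem⟩, fun k => ?_⟩
  rw [← v.repr_apply_apply, LinearIsometryEquiv.apply_symm_apply]

lemma summable_norm_sq_of_le_add {E F G : Type*} [SeminormedAddCommGroup E]
    [SeminormedAddCommGroup F] [SeminormedAddCommGroup G] {c : ℕ → E} {x : ℕ → F} {y : ℕ → G}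
    {a b : ℝ} (hx : Summable fun k => ‖x k‖ ^ 2) (hy : Summable fun k => ‖y k‖ ^ 2)
    (h : ∀ k, ‖c k‖ ≤ a * ‖x k‖ + b * ‖y k‖) : Summable fun k => ‖c k‖ ^ 2 := by
  refine Summable.of_nonneg_of_le (fun k => by positivity) (fun k => ?_)
    ((hx.mul_left (2 * a ^ 2)).add (hy.mul_left (2 * b ^ 2)))
  calc ‖c k‖ ^ 2 ≤ (a * ‖x k‖ + b * ‖y k‖) ^ 2 := by gcongr; exact h k
    _ ≤ 2 * a ^ 2 * ‖x k‖ ^ 2 + 2 * b ^ 2 * ‖y k‖ ^ 2 := by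
      nlinarith [sq_nonneg (a * ‖x k‖ - b * ‖y k‖)]

/-- A function with continuous coefficients that are dominated in `ℓ²` is continuous. -/
lemma HilbertBasis.continuousOn_of_inner (v : HilbertBasis ℕ 𝕜 H) {F : ℝ → H} {S : Set ℝ}
    {B : ℕ → ℝ} (hB : Summable fun k => ‖B k‖ ^ 2)
    (hc : ∀ k, ContinuousOn (fun t => (inner 𝕜 (v k) (F t) : 𝕜)) S)
    (hle : ∀ k, ∀ t ∈ S, ‖(inner 𝕜 (v k) (F t) : 𝕜)‖ ≤ B k) : ContinuousOn F S := by
  intro t₀ ht₀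
  have h1 : Filter.Tendsto
      (fun t => ∑' k, ‖(inner 𝕜 (v k) (F t) - inner 𝕜 (v k) (F t₀) : 𝕜)‖ ^ 2)
      (nhdsWithin t₀ S) (nhds (∑' _ : ℕ, (0 : ℝ))) := by
    refine tendsto_tsum_of_dominated_convergence (bound := fun k => (2 * B k) ^ 2)
      ?_ (fun k => ?_) ?_
    · simpa only [mul_pow, Real.norm_eq_abs, sq_abs] using hB.mul_left (2 ^ 2)
    · have : ContinuousWithinAt
          (fun t => ‖(inner 𝕜 (v k) (F t) - inner 𝕜 (v k) (F t₀) : 𝕜)‖ ^ 2) S t₀ :=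
        ((hc k t₀ ht₀).sub continuousWithinAt_const).norm.pow 2
      simpa [ContinuousWithinAt] using this
    · filter_upwards [self_mem_nhdsWithin] with t ht k
      rw [norm_pow, norm_norm]
      gcongr
      refine (norm_sub_le _ _).trans ?_
      linarith [hle k t ht, hle k t₀ ht₀]
  have h2 : ∀ t, ∑' k, ‖(inner 𝕜 (v k) (F t) - inner 𝕜 (v k) (F t₀) : 𝕜)‖ ^ 2
      = ‖F t - F t₀‖ ^ 2 := fun t => by
    simp only [← inner_sub_right]
    exact (v.hasSum_norm_inner_sq _).tsum_eq
  simp only [h2, tsum_zero] at h1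
  rw [ContinuousWithinAt, tendsto_iff_norm_sub_tendsto_zero]
  simpa [Real.sqrt_sq (norm_nonneg _)] using h1.sqrt

variable [NormedSpace ℝ H]

/-- The coefficient functional `x ↦ ⟪e, x⟫`, as a real-linear map. -/
noncomputable def innerRealCLM (𝕜 : Type*) {H : Type*} [RCLike 𝕜] [NormedAddCommGroup H]
    [InnerProductSpace 𝕜 H] [NormedSpace ℝ H] (e : H) : H →L[ℝ] 𝕜 :=
  haveI : IsScalarTower ℝ 𝕜 H := isScalarTower_real
  (innerSL 𝕜 e).restrictScalars ℝ

@[simp]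
lemma innerRealCLM_apply (e x : H) : innerRealCLM 𝕜 e x = inner 𝕜 e x := by
  simp [innerRealCLM]

/-- A function all of whose coefficients satisfy an integrated fractional equation has a Caputo
derivative, provided that the candidate for it is continuous on `(0, T]`. -/
lemma HilbertBasis.hasCaputoDerivOn [CompleteSpace H] (v : HilbertBasis ℕ 𝕜 H) {ρ T : ℝ}
    {u Du : ℝ → H} {G : ℕ → ℝ → 𝕜} (hρ1 : ρ ≤ 1) (hu : ContinuousOn u (Icc 0 T))
    (hDu : ContinuousOn Du (Ioc 0 T)) (hG : ∀ k, ContinuousOn (G k) (Icc 0 T))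
    (hDG : ∀ k, ∀ t ∈ Ioc 0 T, inner 𝕜 (v k) (Du t) = G k t)
    (heq : ∀ k, ∀ t ∈ Icc 0 T,
      fracIntegral (1 - ρ) (fun s => (inner 𝕜 (v k) (u s) - inner 𝕜 (v k) (u 0) : 𝕜)) t
        = ∫ s in (0 : ℝ)..t, G k s) :
    HasCaputoDerivOn ρ T u Du := by
  intro t ht
  -- `Du` need not be integrable at `0`, so integrate from `δ > 0`
  obtain ⟨δ, hδ0, hδt⟩ := exists_between ht.1
  have hδT : δ ≤ T := hδt.le.trans ht.2
  have hsub : Icc δ T ⊆ Ioc 0 T := fun s hs => ⟨hδ0.trans_le hs.1, hs.2⟩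
  have huc : ContinuousOn (fun s => u s - u 0) (Icc 0 T) := hu.sub continuousOn_const
  set F := fracIntegral (1 - ρ) (fun s => u s - u 0) with hF
  have hFk : ∀ k, ∀ s ∈ Icc 0 T, (inner 𝕜 (v k) (F s) : 𝕜) = ∫ r in (0 : ℝ)..s, G k r := by
    intro k s hs
    rw [← innerRealCLM_apply, hF,
      (innerRealCLM 𝕜 (v k)).map_fracIntegral (by linarith) huc hs, ← heq k s hs]
    simp only [innerRealCLM_apply, inner_sub_right]
  have hFs : ∀ s ∈ Icc δ T, F s = F δ + ∫ r in δ..s, Du r := by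
    intro s hs
    refine v.ext_inner fun k => ?_
    have hi : ∀ a b, a ∈ Icc 0 T → b ∈ Icc 0 T → IntervalIntegrable (G k) volume a b :=
      fun a b ha hb => ((hG k).mono (uIcc_subset_Icc ha hb)).intervalIntegrable
    have h0 : (0 : ℝ) ∈ Icc 0 T := ⟨le_rfl, hδ0.le.trans hδT⟩
    have hδ : δ ∈ Icc 0 T := ⟨hδ0.le, hδT⟩
    have hs0 : s ∈ Icc 0 T := ⟨hδ0.le.trans hs.1, hs.2⟩
    have hDi : IntervalIntegrable Du volume δ s := by
      refine ContinuousOn.intervalIntegrable (hDu.mono ?_)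
      rw [uIcc_of_le hs.1]
      exact (Icc_subset_Icc_right hs.2).trans hsub
    have h3 : ∫ r in δ..s, (inner 𝕜 (v k) (Du r) : 𝕜) = ∫ r in δ..s, G k r := by
      refine intervalIntegral.integral_congr fun r hr => ?_
      rw [uIcc_of_le hs.1] at hr
      exact hDG k r (hsub ⟨hr.1, hr.2.trans hs.2⟩)
    have h4 := (innerRealCLM 𝕜 (v k)).intervalIntegral_comp_comm hDi
    simp only [innerRealCLM_apply] at h4
    rw [inner_add_right, hFk k s hs0, hFk k δ hδ, ← h4, h3,
      intervalIntegral.integral_add_adjacent_intervals (hi _ _ h0 hδ) (hi _ _ hδ hs0)]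
  have htm : t ∈ Icc δ T := ⟨hδt.le, ht.2⟩
  have hd := ((hasDerivWithinAt_integral_Icc (hDu.mono hsub) htm).const_add (F δ)).congr
    hFs (hFs t htm)
  refine hd.mono_of_mem_nhdsWithin ?_
  filter_upwards [self_mem_nhdsWithin, mem_nhdsWithin_of_mem_nhds (Ioi_mem_nhds hδt)] with s hs hs'
  exact ⟨le_of_lt hs', hs.2⟩

end Hilbert

/-! ### Self-adjoint operators with an eigenbasis -/

section Operator

variable {𝕜 H : Type*} [RCLike 𝕜] [NormedAddCommGroup H] [InnerProductSpace 𝕜 H] [CompleteSpace H]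
  {A : H →ₗ.[𝕜] H} {e : H} {l : ℝ}

lemma IsSelfAdjoint.inner_eigenvector (hA : IsSelfAdjoint A)
    (he : ∃ h : e ∈ A.domain, A ⟨e, h⟩ = (l : 𝕜) • e) (x : A.domain) :
    inner 𝕜 e (A x) = l * inner 𝕜 e (x : H) := by
  obtain ⟨h, he⟩ := he
  have hf := LinearPMap.adjoint_isFormalAdjoint (T := A) hA.dense_domain
  rw [LinearPMap.isSelfAdjoint_def.1 hA] at hf
  have := hf ⟨e, h⟩ x
  rw [he, inner_smul_left, RCLike.conj_ofReal] at this
  exact this.symm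

/-- A self-adjoint operator is closed, so it may be applied to an eigenvector expansion termwise. -/
lemma IsSelfAdjoint.mem_domain_of_inner (hA : IsSelfAdjoint A) (v : HilbertBasis ℕ 𝕜 H)
    {lam : ℕ → ℝ} (hv : ∀ k, ∃ h : v k ∈ A.domain, A ⟨v k, h⟩ = (lam k : 𝕜) • v k) {x z : H}
    (h : ∀ k, inner 𝕜 (v k) z = lam k * inner 𝕜 (v k) x) :
    ∃ hx : x ∈ A.domain, A ⟨x, hx⟩ = z := by
  have hmem : ∀ k, (v k, (lam k : 𝕜) • v k) ∈ A.graph := fun k => by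
    obtain ⟨hk, hAk⟩ := hv k
    exact A.mem_graph_iff.2 ⟨⟨v k, hk⟩, rfl, hAk⟩
  have hsum : HasSum (fun k => (inner 𝕜 (v k) x : 𝕜) • (v k, (lam k : 𝕜) • v k)) (x, z) := by
    refine (v.hasSum_inner_smul x).prodMk ?_
    convert v.hasSum_inner_smul z using 2 with k
    rw [h, smul_smul, mul_comm]
  have hgraph : (x, z) ∈ A.graph :=
    hA.isClosed.mem_of_tendsto hsum (Filter.Eventually.of_forall fun s =>
      A.graph.sum_mem fun k _ => A.graph.smul_mem _ (hmem k))
  obtain ⟨y, hy, hAy⟩ := A.mem_graph_iff.1 hgraph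
  simp only at hy hAy
  subst hy
  exact ⟨y.2, hAy⟩

end Operator

/-! ### The inverse problem -/

section Inverse

variable {𝕜 H : Type*} [RCLike 𝕜] [NormedAddCommGroup H] [InnerProductSpace 𝕜 H]
  [NormedSpace ℝ H] [CompleteSpace H]

/-- The integral of a coefficient of the solution over `[0, T]`. -/
lemma integral_relaxFun_add_qCoeff {ρ T : ℝ} {g : ℝ → ℝ} (hρ : 0 < ρ) (lam : ℝ) (hT : 0 < T)
    (hg : ContinuousOn g (Icc 0 T)) (a φ : 𝕜) :
    ∫ t in (0 : ℝ)..T, (relaxFun ρ lam t • φ + qCoeff g ρ lam t • a)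
      = φ * ((T * mittagLeffler ρ 2 (-lam * T ^ ρ) : ℝ) : 𝕜) + ((pCoeff g ρ lam T : ℝ) : 𝕜) * a := by
  have hq := continuousOn_qCoeff hρ lam hT.le hg
  rw [← uIcc_of_le hT.le] at hq
  rw [intervalIntegral.integral_add, intervalIntegral.integral_smul_const,
    intervalIntegral.integral_smul_const, integral_relaxFun hρ lam hT,
    integral_qCoeff hρ lam hT.le hg, RCLike.real_smul_eq_coe_mul, RCLike.real_smul_eq_coe_mul,
    mul_comm φ]
  · exact ((continuous_relaxFun hρ lam).continuousOn.smul continuousOn_const).intervalIntegrable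
  · exact (hq.smul continuousOn_const).intervalIntegrable

/-- The coefficients of a classical solution are those of the asserted series: the `k`-th one solves
a scalar Cauchy problem, and the integral condition then determines `⟪v k, f⟫`. -/
lemma IsClassicalSolution.inner_eq {A : H →ₗ.[𝕜] H} (hA : IsSelfAdjoint A) {e : H} {lam : ℝ}
    (he : ∃ h : e ∈ A.domain, A ⟨e, h⟩ = (lam : 𝕜) • e) {ρ T : ℝ} (hρ : 0 < ρ) (hρ1 : ρ ≤ 1)
    (hT : 0 < T) {φ ψ : H} {g : ℝ → ℝ} (hg : ContinuousOn g (Icc 0 T))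
    (hp : pCoeff g ρ lam T ≠ 0) {u : ℝ → H} {f : H}
    (h : IsClassicalSolution A ρ T g φ ψ u f) :
    inner 𝕜 e f = sourceCoeff g ρ T lam (inner 𝕜 e φ) (inner 𝕜 e ψ) ∧
    ∀ t ∈ Icc 0 T, inner 𝕜 e (u t)
      = relaxFun ρ lam t • inner 𝕜 e φ + qCoeff g ρ lam t • (inner 𝕜 e f : 𝕜) := by
  obtain ⟨Du, Au, hD, hAu, -, -, heq⟩ := h.equation
  have hcap := hD.clm_comp (innerRealCLM 𝕜 e) hρ1 h.continuousOn
  have hu : ContinuousOn (fun s => innerRealCLM 𝕜 e (u s)) (Icc 0 T) :=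
    (innerRealCLM 𝕜 e).continuous.comp_continuousOn h.continuousOn
  have hcoef : ∀ t ∈ Icc 0 T, inner 𝕜 e (u t)
      = relaxFun ρ lam t • inner 𝕜 e φ + qCoeff g ρ lam t • (inner 𝕜 e f : 𝕜) := fun t ht => by
    have := hcap.eq_of_add_smul_eq (lam := lam) (g := g) (a := (inner 𝕜 e f : 𝕜)) hρ hρ1 hT hg hu
      (fun s hs => ?_) ht
    · simpa only [innerRealCLM_apply, h.initial] using this
    · obtain ⟨hs0, hs1⟩ := hAu s hs
      have h2 := congrArg (inner 𝕜 e) (heq s hs)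
      rw [← hs1, inner_add_right, hA.inner_eigenvector he, inner_smul_right] at h2
      simpa only [innerRealCLM_apply, RCLike.real_smul_eq_coe_mul] using h2
  refine ⟨?_, hcoef⟩
  have hui : IntervalIntegrable u volume 0 T := by
    refine ContinuousOn.intervalIntegrable ?_
    rw [uIcc_of_le hT.le]
    exact h.continuousOn
  have h3 := (innerRealCLM 𝕜 e).intervalIntegral_comp_comm hui
  rw [h.integral] at h3
  simp only [innerRealCLM_apply] at h3
  rw [intervalIntegral.integral_congr (fun t ht => hcoef t (by rwa [uIcc_of_le hT.le] at ht)),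
    integral_relaxFun_add_qCoeff hρ lam hT hg] at h3
  rw [sourceCoeff, eq_div_iff (RCLike.ofReal_ne_zero.2 hp), ← h3]
  ring

lemma norm_sourceCoeff_le {g : ℝ → ℝ} {ρ T lam c : ℝ} (hρ : 0 < ρ) (hρ1 : ρ ≤ 1)
    (hT : 0 < T) (hlam : 0 < lam) (hc : 0 < c) (hp : c ≤ lam * |pCoeff g ρ lam T|) (φ ψ : 𝕜) :
    ‖sourceCoeff g ρ T lam φ ψ‖
      ≤ Real.Gamma ρ / T ^ (ρ - 1) / c * ‖φ‖ + 1 / c * ‖(lam : 𝕜) * ψ‖ := by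
  have hK := mul_integral_relaxFun_le hρ hρ1 hlam.le hT
  rw [integral_relaxFun hρ lam hT] at hK
  have h0 : 0 ≤ T * mittagLeffler ρ 2 (-lam * T ^ ρ) := by
    rw [← integral_relaxFun hρ lam hT]
    exact intervalIntegral.integral_nonneg hT.le fun s hs => relaxFun_nonneg hρ hρ1 hlam.le hs.1
  set X := T * mittagLeffler ρ 2 (-lam * T ^ ρ)
  set K := Real.Gamma ρ / T ^ (ρ - 1)
  have hp0 : 0 < |pCoeff g ρ lam T| := pos_of_mul_pos_right (hc.trans_le hp) hlam.le
  have hnum : ‖ψ - φ * (X : 𝕜)‖ ≤ ‖ψ‖ + ‖φ‖ * X := by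
    refine (norm_sub_le _ _).trans ?_
    rw [norm_mul, RCLike.norm_ofReal, abs_of_nonneg h0]
  rw [sourceCoeff, norm_div, RCLike.norm_ofReal, norm_mul, RCLike.norm_ofReal, abs_of_pos hlam]
  calc ‖ψ - φ * (X : 𝕜)‖ / |pCoeff g ρ lam T|
      ≤ (‖ψ‖ + ‖φ‖ * X) / |pCoeff g ρ lam T| := by gcongr
    _ = (lam * ‖ψ‖ + ‖φ‖ * (lam * X)) / (lam * |pCoeff g ρ lam T|) := by field_simp
    _ ≤ (lam * ‖ψ‖ + ‖φ‖ * K) / c := by gcongr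
    _ = K / c * ‖φ‖ + 1 / c * (lam * ‖ψ‖) := by ring

/-- A vector `f` and a function `u` whose coefficients solve the scalar problems form a classical
solution. Continuity of `u` and `A u` and the values in the domain follow from the `ℓ²` bounds
`|y| ≤ 1`, `λ |q| ≤ sup |g|` and `λ y(t) ≤ C t ^ (-ρ)`. -/
lemma isClassicalSolution_of_inner {A : H →ₗ.[𝕜] H} (hA : IsSelfAdjoint A)
    (v : HilbertBasis ℕ 𝕜 H) {lam : ℕ → ℝ}
    (hv : ∀ k, ∃ h : v k ∈ A.domain, A ⟨v k, h⟩ = (lam k : 𝕜) • v k) {lam₀ : ℝ}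
    (hlam₀ : 0 < lam₀) (hlam : ∀ k, lam₀ ≤ lam k) {ρ T : ℝ} (hρ : 0 < ρ) (hρ1 : ρ ≤ 1)
    (hT : 0 < T) {φ ψ : H} {g : ℝ → ℝ} (hg : ContinuousOn g (Icc 0 T)) {u : ℝ → H} {f : H}
    (hp : ∀ k, pCoeff g ρ (lam k) T ≠ 0)
    (hf : ∀ k, inner 𝕜 (v k) f
      = sourceCoeff g ρ T (lam k) (inner 𝕜 (v k) φ) (inner 𝕜 (v k) ψ))
    (hu : ∀ t ∈ Icc 0 T, ∀ k, inner 𝕜 (v k) (u t)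
      = relaxFun ρ (lam k) t • inner 𝕜 (v k) φ + qCoeff g ρ (lam k) t • (inner 𝕜 (v k) f : 𝕜)) :
    IsClassicalSolution A ρ T g φ ψ u f := by
  have hlam0 : ∀ k, 0 < lam k := fun k => hlam₀.trans_le (hlam k)
  obtain ⟨M, hM⟩ := isCompact_Icc.exists_bound_of_continuousOn hg
  have hM0 : 0 ≤ M := (norm_nonneg _).trans (hM 0 (left_mem_Icc.2 hT.le))
  have hφs := (v.hasSum_norm_inner_sq φ).summable
  have hfs := (v.hasSum_norm_inner_sq f).summable
  have hq : ∀ k, ∀ t ∈ Icc 0 T, lam k * |qCoeff g ρ (lam k) t| ≤ M := fun k t ht =>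
    mul_abs_qCoeff_le hρ hρ1 (hlam0 k).le hM ht
  have hcc : ∀ k, ContinuousOn (fun t => (relaxFun ρ (lam k) t • inner 𝕜 (v k) φ
      + qCoeff g ρ (lam k) t • inner 𝕜 (v k) f : 𝕜)) (Icc 0 T) := fun k =>
    ((continuous_relaxFun hρ _).continuousOn.smul continuousOn_const).add
      ((continuousOn_qCoeff hρ _ hT.le hg).smul continuousOn_const)
  have hucc : ∀ k, ContinuousOn (fun t => (inner 𝕜 (v k) (u t) : 𝕜)) (Icc 0 T) := fun k =>
    (hcc k).congr fun t ht => hu t ht k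
  have hnorm : ∀ k, ∀ t ∈ Icc 0 T, ‖(inner 𝕜 (v k) (u t) : 𝕜)‖
      ≤ relaxFun ρ (lam k) t * ‖(inner 𝕜 (v k) φ : 𝕜)‖
        + |qCoeff g ρ (lam k) t| * ‖(inner 𝕜 (v k) f : 𝕜)‖ := fun k t ht => by
    rw [hu t ht k]
    refine (norm_add_le _ _).trans ?_
    rw [norm_smul, norm_smul, Real.norm_eq_abs, Real.norm_eq_abs,
      abs_of_nonneg (relaxFun_nonneg hρ hρ1 (hlam0 k).le ht.1)]
  -- `u` is continuous on `[0, T]`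
  have hcont : ContinuousOn u (Icc 0 T) := by
    refine v.continuousOn_of_inner (B := fun k => 1 * ‖(inner 𝕜 (v k) φ : 𝕜)‖
      + M / lam₀ * ‖(inner 𝕜 (v k) f : 𝕜)‖) ?_ hucc fun k t ht => ?_
    · refine summable_norm_sq_of_le_add (a := 1) (b := M / lam₀) hφs hfs fun k => ?_
      rw [Real.norm_of_nonneg (by positivity)]
    · refine (hnorm k t ht).trans ?_
      have h1 := relaxFun_le_one hρ hρ1 (hlam0 k).le ht.1
      have h2 : |qCoeff g ρ (lam k) t| ≤ M / lam₀ := by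
        rw [le_div_iff₀' hlam₀]
        exact (mul_le_mul_of_nonneg_right (hlam k) (abs_nonneg _)).trans (hq k t ht)
      gcongr
  -- the values `A u(t)` for `t > 0`
  have hAbound : ∀ δ > 0, ∀ k, ∀ t ∈ Icc δ T, ‖(lam k * inner 𝕜 (v k) (u t) : 𝕜)‖
      ≤ Real.Gamma ρ * ρ / δ ^ ρ * ‖(inner 𝕜 (v k) φ : 𝕜)‖
        + M * ‖(inner 𝕜 (v k) f : 𝕜)‖ := fun δ hδ k t ht => by
    have ht0 : 0 < t := hδ.trans_le ht.1
    have htI : t ∈ Icc 0 T := ⟨ht0.le, ht.2⟩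
    have hG := Real.Gamma_pos_of_pos hρ
    have h1 : lam k * relaxFun ρ (lam k) t ≤ Real.Gamma ρ * ρ / δ ^ ρ :=
      (mul_relaxFun_le hρ hρ1 (hlam0 k).le ht0).trans (by gcongr; exact ht.1)
    rw [norm_mul, RCLike.norm_ofReal, abs_of_pos (hlam0 k)]
    calc lam k * ‖(inner 𝕜 (v k) (u t) : 𝕜)‖
        ≤ lam k * (relaxFun ρ (lam k) t * ‖(inner 𝕜 (v k) φ : 𝕜)‖
          + |qCoeff g ρ (lam k) t| * ‖(inner 𝕜 (v k) f : 𝕜)‖) :=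
          mul_le_mul_of_nonneg_left (hnorm k t htI) (hlam0 k).le
      _ = lam k * relaxFun ρ (lam k) t * ‖(inner 𝕜 (v k) φ : 𝕜)‖
          + lam k * |qCoeff g ρ (lam k) t| * ‖(inner 𝕜 (v k) f : 𝕜)‖ := by ring
      _ ≤ _ := by gcongr; exact hq k t htI
  have hAu : ∀ t, ∃ z : H, t ∈ Ioc 0 T →
      ∀ k, inner 𝕜 (v k) z = (lam k * inner 𝕜 (v k) (u t) : 𝕜) := fun t => by
    by_cases ht : t ∈ Ioc 0 T
    · obtain ⟨z, hz⟩ := v.exists_inner_eq (c := fun k => (lam k * inner 𝕜 (v k) (u t) : 𝕜))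
        (summable_norm_sq_of_le_add hφs hfs fun k => hAbound t ht.1 k t ⟨le_rfl, ht.2⟩)
      exact ⟨z, fun _ => hz⟩
    · exact ⟨0, fun h => absurd h ht⟩
  choose Au hAu using hAu
  have hAcont : ContinuousOn Au (Ioc 0 T) := by
    intro t ht
    obtain ⟨δ, hδ0, hδt⟩ := exists_between ht.1
    have hsub : Icc δ T ⊆ Ioc 0 T := fun s hs => ⟨hδ0.trans_le hs.1, hs.2⟩
    have : ContinuousOn Au (Icc δ T) := by
      have hG := Real.Gamma_pos_of_pos hρ
      refine v.continuousOn_of_inner (B := fun k => Real.Gamma ρ * ρ / δ ^ ρ *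
        ‖(inner 𝕜 (v k) φ : 𝕜)‖ + M * ‖(inner 𝕜 (v k) f : 𝕜)‖) ?_ (fun k => ?_) fun k s hs => ?_
      · refine summable_norm_sq_of_le_add (a := Real.Gamma ρ * ρ / δ ^ ρ) (b := M) hφs hfs
          fun k => ?_
        rw [Real.norm_of_nonneg (by positivity)]
      · exact ((continuousOn_const (c := (lam k : 𝕜))).mul ((hucc k).mono
          (hsub.trans Ioc_subset_Icc_self))).congr fun s hs => hAu s (hsub hs) k
      · rw [hAu s (hsub hs) k]
        exact hAbound δ hδ0 k s hs
    refine (this t ⟨hδt.le, ht.2⟩).mono_of_mem_nhdsWithin ?_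
    filter_upwards [self_mem_nhdsWithin, mem_nhdsWithin_of_mem_nhds (Ioi_mem_nhds hδt)]
      with s hs hs'
    exact ⟨le_of_lt hs', hs.2⟩
  have h0 : u 0 = φ := v.ext_inner fun k => by
    rw [hu 0 (left_mem_Icc.2 hT.le) k, relaxFun_zero hρ, one_smul, qCoeff_eq_truncConv, truncConv,
      intervalIntegral.integral_same, zero_smul, add_zero]
  have hDcont : ContinuousOn (fun t => (g t : 𝕜) • f - Au t) (Ioc 0 T) :=
    ((RCLike.continuous_ofReal.comp_continuousOn (hg.mono Ioc_subset_Icc_self)).smul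
      continuousOn_const).sub hAcont
  refine ⟨hcont, ⟨fun t => (g t : 𝕜) • f - Au t, Au, ?_, ?_, hDcont, hAcont, ?_⟩, h0, ?_⟩
  · refine v.hasCaputoDerivOn (G := fun k t => g t • inner 𝕜 (v k) f - lam k •
      (relaxFun ρ (lam k) t • inner 𝕜 (v k) φ + qCoeff g ρ (lam k) t • (inner 𝕜 (v k) f : 𝕜)))
      hρ1 hcont hDcont (fun k => ?_) (fun k t ht => ?_) fun k t ht => ?_
    · exact (hg.smul continuousOn_const).sub ((hcc k).const_smul (lam k))
    · rw [inner_sub_right, inner_smul_right, hAu t ht k, hu t (Ioc_subset_Icc_self ht) k]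
      simp only [RCLike.real_smul_eq_coe_mul]
    · rw [← fracIntegral_relaxFun_add_qCoeff hρ hρ1 (lam k) hT.le hg _ _ ht, h0]
      have hsub : Icc 0 t ⊆ Icc 0 T := Icc_subset_Icc_right ht.2
      rw [fracIntegral, fracIntegral, hu t ht k]
      congr 2
      refine intervalIntegral.integral_congr fun s hs => ?_
      rw [uIcc_of_le ht.1] at hs
      rw [hu s (hsub hs) k]
  · exact fun t ht => hA.mem_domain_of_inner v hv (hAu t ht)
  · exact fun t _ => sub_add_cancel _ _
  · refine v.ext_inner fun k => ?_
    have hui : IntervalIntegrable u volume 0 T := by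
      refine ContinuousOn.intervalIntegrable ?_
      rwa [uIcc_of_le hT.le]
    rw [← innerRealCLM_apply, ← (innerRealCLM 𝕜 (v k)).intervalIntegral_comp_comm hui]
    simp only [innerRealCLM_apply]
    rw [intervalIntegral.integral_congr
      (fun t ht => hu t (by rwa [uIcc_of_le hT.le] at ht) k),
      integral_relaxFun_add_qCoeff hρ (lam k) hT hg, hf k, sourceCoeff,
      mul_div_cancel₀ _ (RCLike.ofReal_ne_zero.2 (hp k)), add_sub_cancel]

end Inverse

theorem mainTheorem1 {𝕜 H : Type*} [RCLike 𝕜] [NormedAddCommGroup H]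
    [InnerProductSpace 𝕜 H] [NormedSpace ℝ H] [CompleteSpace H]
    (A : H →ₗ.[𝕜] H) (hA : IsSelfAdjoint A)
    (hpos : ∃ C : ℝ, 0 < C ∧
      ∀ h : A.domain, C * ‖(h : H)‖ ^ 2 ≤ RCLike.re (inner 𝕜 (A h) (h : H)))
    (v : HilbertBasis ℕ 𝕜 H) (lam : ℕ → ℝ)
    (hv : ∀ k, ∃ h : v k ∈ A.domain, A ⟨v k, h⟩ = (lam k : 𝕜) • v k)
    (hlam_pos : ∀ k, 0 < lam k) (hlam_mono : Monotone lam)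
    (hlam_tendsto : Filter.Tendsto lam Filter.atTop Filter.atTop)
    (ρ T : ℝ) (hρ0 : 0 < ρ) (hρ1 : ρ ≤ 1) (hT : 0 < T)
    (φ ψ : H) (hψ : ψ ∈ A.domain)
    (g : ℝ → ℝ) (hg : ContinuousOn g (Icc 0 T)) (hg0 : ∀ t ∈ Icc 0 T, g t ≠ 0) :
    (∀ k, pCoeff g ρ (lam k) T ≠ 0) ∧
    ∃ (u : ℝ → H) (f : H),
      IsClassicalSolution A ρ T g φ ψ u f ∧
      (∀ (u' : ℝ → H) (f' : H), IsClassicalSolution A ρ T g φ ψ u' f' →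
        EqOn u' u (Icc 0 T) ∧ f' = f) ∧
      HasSum (fun k => sourceCoeff g ρ T (lam k) (inner 𝕜 (v k) φ) (inner 𝕜 (v k) ψ) • v k) f ∧
      ∀ t ∈ Icc 0 T,
        HasSum (fun k =>
          (inner 𝕜 (v k) φ * ((mittagLeffler ρ 1 (-lam k * t ^ ρ) : ℝ) : 𝕜) +
            ((qCoeff g ρ (lam k) t / pCoeff g ρ (lam k) T : ℝ) : 𝕜) *
              (inner 𝕜 (v k) ψ -
                inner 𝕜 (v k) φ * ((T * mittagLeffler ρ 2 (-lam k * T ^ ρ) : ℝ) : 𝕜))) • v k)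
          (u t) := by
  have hlam : ∀ k, lam 0 ≤ lam k := fun k => hlam_mono (Nat.zero_le k)
  obtain ⟨c, hc, hpc⟩ := exists_pos_le_mul_abs_pCoeff hρ0 hρ1 hT (hlam_pos 0) hg hg0
  have hp : ∀ k, pCoeff g ρ (lam k) T ≠ 0 := fun k h => by
    have := hpc (lam k) (hlam k)
    rw [h, abs_zero, mul_zero] at this
    exact absurd this (not_le.2 hc)
  refine ⟨hp, ?_⟩
  have hφs := (v.hasSum_norm_inner_sq φ).summable
  -- `λ_k ψ_k` are the coefficients of `A ψ`
  have hψs : Summable fun k => ‖((lam k : 𝕜) * inner 𝕜 (v k) ψ)‖ ^ 2 := by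
    refine (v.hasSum_norm_inner_sq (A ⟨ψ, hψ⟩)).summable.congr fun k => ?_
    rw [hA.inner_eigenvector (hv k)]
  obtain ⟨f, hf⟩ := v.exists_inner_eq (summable_norm_sq_of_le_add hφs hψs fun k =>
    norm_sourceCoeff_le hρ0 hρ1 hT (hlam_pos k) hc (hpc (lam k) (hlam k))
      (inner 𝕜 (v k) φ) (inner 𝕜 (v k) ψ))
  have hfs := (v.hasSum_norm_inner_sq f).summable
  obtain ⟨M, hM⟩ := isCompact_Icc.exists_bound_of_continuousOn hg
  have hex : ∀ t, ∃ x : H, t ∈ Icc 0 T → ∀ k, inner 𝕜 (v k) x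
      = relaxFun ρ (lam k) t • inner 𝕜 (v k) φ
        + qCoeff g ρ (lam k) t • (inner 𝕜 (v k) f : 𝕜) := fun t => by
    by_cases ht : t ∈ Icc 0 T
    · obtain ⟨x, hx⟩ := v.exists_inner_eq (c := fun k => relaxFun ρ (lam k) t • inner 𝕜 (v k) φ
          + qCoeff g ρ (lam k) t • (inner 𝕜 (v k) f : 𝕜))
        (summable_norm_sq_of_le_add (a := 1) (b := M / lam 0) hφs hfs fun k => by
          refine (norm_add_le _ _).trans ?_
          rw [norm_smul, norm_smul, Real.norm_eq_abs, Real.norm_eq_abs,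
            abs_of_nonneg (relaxFun_nonneg hρ0 hρ1 (hlam_pos k).le ht.1)]
          have h1 := relaxFun_le_one hρ0 hρ1 (hlam_pos k).le ht.1
          have h2 : |qCoeff g ρ (lam k) t| ≤ M / lam 0 := by
            rw [le_div_iff₀' (hlam_pos 0)]
            exact (mul_le_mul_of_nonneg_right (hlam k) (abs_nonneg _)).trans
              (mul_abs_qCoeff_le hρ0 hρ1 (hlam_pos k).le hM ht)
          gcongr)
      exact ⟨x, fun _ => hx⟩
    · exact ⟨0, fun h => absurd h ht⟩
  choose u hu using hex
  refine ⟨u, f, isClassicalSolution_of_inner hA v hv (hlam_pos 0) hlam hρ0 hρ1 hT hg hp hf hu,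
    fun u' f' h' => ?_, ?_, fun t ht => ?_⟩
  · have hff : f' = f := v.ext_inner fun k =>
      (h'.inner_eq hA (hv k) hρ0 hρ1 hT hg (hp k)).1.trans (hf k).symm
    refine ⟨fun t ht => v.ext_inner fun k => ?_, hff⟩
    rw [(h'.inner_eq hA (hv k) hρ0 hρ1 hT hg (hp k)).2 t ht, hu t ht k, hff]
  · simpa only [hf] using v.hasSum_inner_smul f
  · convert v.hasSum_inner_smul (u t) using 2 with k
    congr 1
    rw [hu t ht k, hf k, sourceCoeff, RCLike.real_smul_eq_coe_mul, RCLike.real_smul_eq_coe_mul,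
      RCLike.ofReal_div, relaxFun]
    ring
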